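/- Call a symmetric matrix $\mu=(\mu_{ij})_{i,j\ge 1}$ of non-negative numbers with $0<\sum_{i,j}\mu_{ij}<\infty$ an intensity matrix. Given such a matrix, let $Y_1,Y_2,\dots$ be i.i.d. random unordered pairs $\{i,j\}$ of positive integers (with $i=j$ allowed), where $\{i,j\}$ has probability proportional to $\mu_{ij}$, and let $G_m$ be the random simple graph whose edges are the distinct pairs among $Y_1,\dots,Y_m$ that are not loops, and whose vertices are the endpoints of these edges; $v(G_m)$ denotes its number of vertices. A graphon is a symmetric measurable function $W:S\times S\to[0,1]$ on a probability space $S$. The cut norm of an integrable function $F$ on $\Omega\times\Omega$, for a probability space $(\Omega,P)$, is $\|F\|_\square=\sup_{T,U}\bigl|\int_{T\times U}F\,d(P\times P)\bigr|$, over measurable $T,U\subseteq\Omega$. The cut distance of graphons $W_1,W_2$ on $\Omega_1,\Omega_2$ is $\delta_\square(W_1,W_2)=\inf\|W_1^{\varphi_1}-W_2^{\varphi_2}\|_\square$, over all measure preserving maps $\varphi_j:\Omega\to\Omega_j$ from a common probability space $\Omega$, where $W^{\varphi}(x,y)=W(\varphi(x),\varphi(y))$. A graph limit is an equivalence class of graphons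 at cut distance $0$. A finite non-empty graph $G$ is identified with the graphon on its vertex set with uniform distribution that is given by the adjacency matrix of $G$. Graphs $H_1,H_2,\dots$ converge to a graph limit, represented by a graphon $W$, if $v(H_\ell)\to\infty$ and $\delta_\square(H_\ell,W)\to0$. **Theorem.** There exists an intensity matrix $\mu$ such that, almost surely, the simple graphs $G_m$ are dense in the space of graph limits: for every graph limit, represented by a graphon $W$, there is a sequence $m_1<m_2<\cdots$ such that $G_{m_\ell}$ converges to it, that is, $v(G_{m_\ell})\to\infty$ and $\delta_\square(G_{m_\ell},W)\to0$ as $\ell\to\infty$. -/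

import Mathlib

open MeasureTheory ProbabilityTheory Filter Topology

universe u v

noncomputable section

namespace EdgeExchangeable

/-- A graphon on a measurable space `Ω`: a symmetric (jointly) measurable function
`Ω × Ω → [0, 1]`. The probability measure on `Ω` is supplied separately. -/
structure Graphon (Ω : Type u) [MeasurableSpace Ω] where
  /-- the underlying function -/
  toFun : Ω → Ω → ℝ
  measurable : Measurable (Function.uncurry toFun)
  symm : ∀ x y, toFun x y = toFun y x
  mem_Icc : ∀ x y, toFun x y ∈ Set.Icc (0 : ℝ) 1

/-- The cut norm `sup |∫_{T × U} F d(P × P)|`, over all measurable sets `T, U ⊆ Ω`. -/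
def cutNorm {Ω : Type u} [MeasurableSpace Ω] (P : Measure Ω) (F : Ω → Ω → ℝ) : ℝ :=
  sSup {r : ℝ | ∃ T U : Set Ω, MeasurableSet T ∧ MeasurableSet U ∧
    r = |∫ z in T ×ˢ U, F z.1 z.2 ∂(P.prod P)|}

/-- The cut distance of a graphon `W₁` on `(Ω₁, P₁)` and a graphon `W₂` on `(Ω₂, P₂)`: the infimum
of `‖W₁^φ₁ - W₂^φ₂‖_□` over all pairs of measure preserving maps `φ₁, φ₂` from a common
probability space to `Ω₁` and `Ω₂`. -/
def cutDist {Ω₁ : Type u} {Ω₂ : Type v} [MeasurableSpace Ω₁] [MeasurableSpace Ω₂]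
    (P₁ : Measure Ω₁) (W₁ : Graphon Ω₁) (P₂ : Measure Ω₂) (W₂ : Graphon Ω₂) : ℝ :=
  sInf {d : ℝ | ∃ (Ω : Type (max u v)) (_ : MeasurableSpace Ω) (P : Measure Ω)
    (φ₁ : Ω → Ω₁) (φ₂ : Ω → Ω₂), IsProbabilityMeasure P ∧
      MeasurePreserving φ₁ P P₁ ∧ MeasurePreserving φ₂ P P₂ ∧
      d = cutNorm P (fun x y => W₁.toFun (φ₁ x) (φ₁ y) - W₂.toFun (φ₂ x) (φ₂ y))}

open Classical in
/-- The graphon `W_G` of a graph `G` on a finite set of vertices: its adjacency matrix.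
The vertex set carries the uniform distribution, see `cutDistGraph`. -/
def graphonOf {V : Type u} [Fintype V] [MeasurableSpace V] [DiscreteMeasurableSpace V]
    (G : SimpleGraph V) : Graphon V where
  toFun i j := if G.Adj i j then 1 else 0
  measurable := .of_discrete
  symm i j := by simp only [G.adj_comm]
  mem_Icc i j := by split_ifs <;> simp

/-- The cut distance of a (non-empty) finite graph `G` and a graphon `W` on `(S, ν)`, where `G` is
identified with the graphon `W_G` on its vertex set with the uniform distribution. -/
def cutDistGraph {V : Type u} [Fintype V] [MeasurableSpace V] [DiscreteMeasurableSpace V]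
    (G : SimpleGraph V) {S : Type v} [MeasurableSpace S] (ν : Measure S) (W : Graphon S) : ℝ :=
  cutDist (uniformOn (Set.univ : Set V)) (graphonOf G) ν W

/-- An intensity matrix: an infinite symmetric matrix of non-negative numbers, with finite and
non-zero total mass. -/
structure IntensityMatrix where
  /-- the entries; `val i j` is the intensity of edges `ij` -/
  val : ℕ → ℕ → ℝ
  symm : ∀ i j, val i j = val j i
  nonneg : ∀ i j, 0 ≤ val i j
  summable : Summable (Function.uncurry val)
  ne_zero : ∃ i j, val i j ≠ 0

/-- Mathlib's (quotient) σ-algebra on the countable set of unordered pairs is the discrete one. -/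
instance : DiscreteMeasurableSpace (Sym2 ℕ) :=
  ⟨fun s => show MeasurableSet ((Quot.mk _ : ℕ × ℕ → Sym2 ℕ) ⁻¹' s) from .of_discrete⟩

namespace IntensityMatrix

/-- The intensity `μ_ij` of the unordered pair `{i, j}`. -/
def edge (μ : IntensityMatrix) : Sym2 ℕ → ℝ := Sym2.lift ⟨μ.val, μ.symm⟩

/-- The finite measure on unordered pairs (loops `{i, i}` included) that gives `{i, j}` the mass `μ_ij`. -/
def edgeMeasure (μ : IntensityMatrix) : Measure (Sym2 ℕ) :=
  Measure.sum fun e => ENNReal.ofReal (μ.edge e) • Measure.dirac e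

/-- The distribution of a random edge: `edgeMeasure μ` normalized to a probability measure. -/
def edgeLaw (μ : IntensityMatrix) : Measure (Sym2 ℕ) :=
  (μ.edgeMeasure Set.univ)⁻¹ • μ.edgeMeasure

end IntensityMatrix

/-- The edge set of the simple graph `G_m` built from the sequence `y 0, y 1, …` of edges:
the first `m` edges, with parallel edges merged and loops deleted. -/
def edges (y : ℕ → Sym2 ℕ) (m : ℕ) : Finset (Sym2 ℕ) :=
  ((Finset.range m).image y).filter fun e => ¬ e.IsDiag

/-- The vertex set of `G_m`: the endpoints of its edges. -/
def verts (y : ℕ → Sym2 ℕ) (m : ℕ) : Finset ℕ :=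
  (edges y m).biUnion Sym2.toFinset

/-- The simple graph `G_m`. -/
def simpleGraph (y : ℕ → Sym2 ℕ) (m : ℕ) : SimpleGraph (verts y m) where
  Adj i j := s(i.1, j.1) ∈ edges y m
  symm.symm i j h := by rwa [Sym2.eq_swap]
  loopless.irrefl i h := by simp [edges] at h

/-- The graphs `G_{m_0}, G_{m_1}, …` converge to the graph limit represented by the graphon `W` on
the probability space `(S, ν)`: the number of vertices tends to infinity, and the cut distance
to `W` tends to `0`. -/
def ConvergesAlong (y : ℕ → Sym2 ℕ) (m : ℕ → ℕ)
    {S : Type v} [MeasurableSpace S] (ν : Measure S) (W : Graphon S) : Prop :=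
  Tendsto (fun l => (verts y (m l)).card) atTop atTop ∧
    Tendsto (fun l => cutDistGraph (simpleGraph y (m l)) ν W) atTop (𝓝 0)

end EdgeExchangeable

end
open EdgeExchangeable

/-! One deterministic graph Γ on ℕ carries the theorem. Its initial segments Γ[0..n] are dense among
graph limits, and the intensities decay so fast that almost surely, for all large n, some G_m equals
Γ[0..n].

Γ comes from `exists_universal_graph`. Rational step functions are dense in L¹, and up to rounding
their parts may be taken equally large, so countably many density matrices (`Template`) suffice. Γ
is a sequence of blocks, each quasirandom for one matrix and far larger than everything before it;
each matrix is used infinitely often, and a segment that ends with its block is close to it in cut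
norm. The blocks are explicit: on the plane over F_q, the relation is that x₁y₁ + x₂ + y₂ lies in a
set of the right density. Rows with different x₁ are uncorrelated, and Cauchy–Schwarz gives a cut
norm of order q^(-1/2). Vertex 0 is joined to all others, since G_m cannot have isolated vertices.

The segments are seen by `ae_eventually_edges_eq`. An edge with larger endpoint n has intensity
16^(-n²). Up to time 16^(n²)·4^n, each edge of Γ[0..n] has an expected number of occurrences of
order at least 4^n, and all later edges together one of order at most 4^(-n); Borel–Cantelli
applies.

Finally `cutDistGraph_le` compares a segment with a graphon: a coupling of the vertices with the
probability space makes the classes agree off a small set, and both sides are then close to the same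
step function. -/

noncomputable section

namespace EdgeExchangeable

/-! ### Quasirandom graphs from the plane over a finite field -/

/-- The symmetric function `(x, y) ↦ x₁ y₁ + x₂ + y₂` on the affine plane over `K`. -/
def planeForm {K : Type*} [Field K] (x y : K × K) : K := x.1 * y.1 + x.2 + y.2

lemma planeForm_comm {K : Type*} [Field K] (x y : K × K) : planeForm x y = planeForm y x := by
  unfold planeForm; ring

/-- For distinct slopes `x.1`, `x'.1`, the difference of the two values determines `y.1`, and then
either value determines `y.2`. -/
lemma planeForm_pair_bijective {K : Type*} [Field K] [Finite K] {x x' : K × K} (h : x.1 ≠ x'.1) :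
    Function.Bijective fun y : K × K => (planeForm x y, planeForm x' y) := by
  refine Function.Injective.bijective_of_finite fun y z hyz => ?_
  simp only [planeForm, Prod.mk.injEq] at hyz
  obtain ⟨h1, h2⟩ := hyz
  have h3 : (x.1 - x'.1) * (y.1 - z.1) = 0 := by linear_combination h1 - h2
  have h4 : y.1 = z.1 :=
    sub_eq_zero.1 ((mul_eq_zero.1 h3).resolve_left (sub_ne_zero.2 h))
  refine Prod.ext h4 ?_
  rw [h4] at h1
  linear_combination h1

/-- For uniform `y` the two values are independent, so the mean of the product is the product of the
means. -/
lemma sum_planeForm_mul_eq_zero {K : Type*} [Field K] [Fintype K] {x x' : K × K}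
    (h : x.1 ≠ x'.1) (φ ψ : K → ℝ) (hφ : ∑ t, φ t = 0) :
    ∑ y, φ (planeForm x y) * ψ (planeForm x' y) = 0 := by
  rw [(planeForm_pair_bijective h).sum_comp (fun p : K × K => φ p.1 * ψ p.2),
    Fintype.sum_prod_type, ← Finset.sum_mul_sum, hφ, zero_mul]

/-- The form with a mean-zero kernel of the plane form is small on functions bounded by `1`. -/
lemma planeForm_kernel_sq_le {ι K : Type*} [Fintype ι] [Field K] [Fintype K]
    (φ : ι → ι → K → ℝ) (hsum : ∀ i j, ∑ t, φ i j t = 0) (hφ : ∀ i j t, |φ i j t| ≤ 1)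
    (f g : ι × K × K → ℝ) (hf : ∀ x, |f x| ≤ 1) (hg : ∀ x, |g x| ≤ 1) :
    (∑ x, ∑ y, f x * g y * φ x.1 y.1 (planeForm x.2 y.2)) ^ 2 * Fintype.card K ≤
      (Fintype.card (ι × K × K) : ℝ) ^ 4 := by
  classical
  set F : ι × K × K → ι × K × K → ℝ := fun x y => φ x.1 y.1 (planeForm x.2 y.2) with hF
  have hF1 : ∀ x y, |F x y| ≤ 1 := fun x y => hφ _ _ _
  have hg2 : ∑ y, g y ^ 2 ≤ Fintype.card (ι × K × K) := by
    refine (Finset.sum_le_card_nsmul _ _ 1 fun y _ => ?_).trans (by simp)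
    exact (sq_le_one_iff_abs_le_one _).2 (hg y)
  have hcorr : ∀ x x' : ι × K × K, f x * f x' * ∑ y, F x y * F x' y ≤
      if x.2.1 = x'.2.1 then (Fintype.card (ι × K × K) : ℝ) else 0 := by
    intro x x'
    split_ifs with h
    · refine (le_abs_self _).trans ?_
      rw [abs_mul, abs_mul]
      have h1 : |f x| * |f x'| ≤ 1 := mul_le_one₀ (hf x) (abs_nonneg _) (hf x')
      have h2 : |∑ y, F x y * F x' y| ≤ Fintype.card (ι × K × K) := by
        refine (Finset.abs_sum_le_sum_abs _ _).trans
          ((Finset.sum_le_card_nsmul _ _ 1 fun y _ => ?_).trans (by simp))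
        rw [abs_mul]
        exact mul_le_one₀ (hF1 _ _) (abs_nonneg _) (hF1 _ _)
      exact (mul_le_of_le_one_left (abs_nonneg _) h1).trans h2
    · have : ∑ y, F x y * F x' y = 0 := by
        rw [Fintype.sum_prod_type]
        exact Finset.sum_eq_zero fun j _ =>
          sum_planeForm_mul_eq_zero h (φ x.1 j) (φ x'.1 j) (hsum _ _)
      rw [this, mul_zero]
  -- Pairs with equal first plane coordinate, the only ones with a non-zero correlation, form a
  -- fraction `1 / |K|` of all pairs. This is the whole gain.
  have hcount : ∑ x : ι × K × K, ∑ x' : ι × K × K,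
      (if x.2.1 = x'.2.1 then (Fintype.card (ι × K × K) : ℝ) else 0) * Fintype.card K =
      (Fintype.card (ι × K × K) : ℝ) ^ 3 := by
    set δ : K → K → ℝ := fun s t => if s = t then (Fintype.card (ι × K × K) : ℝ) else 0 with hδ
    change ∑ x : ι × K × K, ∑ x' : ι × K × K, δ x.2.1 x'.2.1 * Fintype.card K = _
    simp only [Fintype.sum_prod_type, Finset.sum_const, Finset.card_univ, nsmul_eq_mul]
    simp only [← Finset.mul_sum, ← Finset.sum_mul, hδ, Finset.sum_ite_eq, Finset.mem_univ, if_true,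
      Finset.sum_const, Finset.card_univ, nsmul_eq_mul, Fintype.card_prod, Nat.cast_mul]
    ring
  have hsq : ∑ y, (∑ x, f x * F x y) ^ 2 =
      ∑ x, ∑ x', f x * f x' * ∑ y, F x y * F x' y := by
    simp_rw [sq, Finset.sum_mul_sum, Finset.mul_sum]
    rw [Finset.sum_comm]
    refine Finset.sum_congr rfl fun x _ => ?_
    rw [Finset.sum_comm]
    refine Finset.sum_congr rfl fun x' _ => Finset.sum_congr rfl fun y _ => ?_
    ring
  have hswap : ∑ x, ∑ y, f x * g y * F x y = ∑ y, g y * ∑ x, f x * F x y := by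
    rw [Finset.sum_comm]
    simp_rw [Finset.mul_sum]
    exact Finset.sum_congr rfl fun y _ => Finset.sum_congr rfl fun x _ => by ring
  rw [hswap]
  -- Cauchy–Schwarz in `y` removes `g` and leaves correlations of pairs of rows.
  calc (∑ y, g y * ∑ x, f x * F x y) ^ 2 * Fintype.card K
      ≤ ((∑ y, g y ^ 2) * ∑ y, (∑ x, f x * F x y) ^ 2) * Fintype.card K := by
        gcongr; exact Finset.sum_mul_sq_le_sq_mul_sq _ _ _
    _ ≤ (Fintype.card (ι × K × K) * ∑ y, (∑ x, f x * F x y) ^ 2) * Fintype.card K := by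
        gcongr
    _ ≤ (Fintype.card (ι × K × K) * ∑ x : ι × K × K, ∑ x' : ι × K × K,
        (if x.2.1 = x'.2.1 then (Fintype.card (ι × K × K) : ℝ) else 0)) * Fintype.card K := by
        rw [hsq]
        gcongr with x _ x' _
        exact hcorr x x'
    _ = (Fintype.card (ι × K × K) : ℝ) ^ 4 := by
        rw [mul_assoc, Finset.sum_mul]
        simp_rw [Finset.sum_mul]
        rw [hcount]; ring

/-- Quasirandom graphs with prescribed edge densities between equally large classes. -/
lemma exists_quasirandom_relation {M : ℕ} (hM : 0 < M) (w : Fin M → Fin M → ℝ)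
    (hsymm : ∀ i j, w i j = w j i) (hw : ∀ i j, w i j ∈ Set.Icc (0 : ℝ) 1)
    (n₀ : ℕ) {ε : ℝ} (hε : 0 < ε) :
    ∃ (n : ℕ) (A : ℕ → ℕ → Prop) (c : ℕ → Fin M), n₀ ≤ n ∧ (∀ x y, A x y → A y x) ∧
      (∀ k, ((Finset.range n).filter fun x => c x = k).card * M = n) ∧
      ∀ (a : ℕ → ℕ → ℝ), (∀ x y, A x y → a x y = 1) → (∀ x y, ¬ A x y → a x y = 0) →
      ∀ f g : ℕ → ℝ, (∀ x, |f x| ≤ 1) → (∀ x, |g x| ≤ 1) →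
        |∑ x ∈ Finset.range n, ∑ y ∈ Finset.range n, f x * g y * (a x y - w (c x) (c y))| ≤
          ε * n ^ 2 := by
  classical
  -- `(2 / ε) ^ 2 ≤ q` makes the quasirandom error at most `ε / 2`, and `2 / ε ≤ q` does so for the
  -- error of rounding densities to multiples of `1 / q`.
  obtain ⟨q, hq, hprime⟩ := Nat.exists_infinite_primes (max (n₀ + 1) (⌈(2 / ε) ^ 2 + 2 / ε⌉₊ + 1))
  have : Fact q.Prime := ⟨hprime⟩
  have hq0 : 0 < q := hprime.pos
  have hqR : (0 : ℝ) < q := by exact_mod_cast hq0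
  have hqn : n₀ ≤ q := by have := le_of_max_le_left hq; omega
  have hqε : (2 / ε) ^ 2 + 2 / ε ≤ q := by
    have h1 := le_of_max_le_right hq
    exact (Nat.le_ceil _).trans (by exact_mod_cast (by omega))
  let X := Fin M × ZMod q × ZMod q
  have hcard : Fintype.card X = M * (q * q) := by simp [X, ZMod.card]
  set n := Fintype.card X with hn
  let e : X ≃ Fin n := Fintype.equivFin X
  have hnpos : 0 < n := by rw [hcard]; positivity
  have : NeZero n := ⟨hnpos.ne'⟩
  let d : ℕ → X := fun x => e.symm (Fin.ofNat n x)
  have hsumd : ∀ F : X → ℝ, ∑ x ∈ Finset.range n, F (d x) = ∑ x, F x := by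
    intro F
    rw [← e.symm.sum_comp F, Finset.sum_range]
    refine Finset.sum_congr rfl fun x _ => ?_
    simp [d]
  have hJ : ∀ r : ℕ, ∃ J : Finset (ZMod q), r ≤ q → J.card = r := by
    intro r
    by_cases hr : r ≤ q
    · obtain ⟨J, -, hJ⟩ := Finset.exists_subset_card_eq
        (s := (Finset.univ : Finset (ZMod q))) (n := r) (by simpa [ZMod.card] using hr)
      exact ⟨J, fun _ => hJ⟩
    · exact ⟨∅, fun h => absurd h hr⟩
  choose J hJ using hJ
  let r : Fin M → Fin M → ℕ := fun i j => ⌊w i j * q⌋₊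
  have hr0 : ∀ i j, (r i j : ℝ) ≤ w i j * q := fun i j =>
    Nat.floor_le (mul_nonneg (hw i j).1 hqR.le)
  have hr : ∀ i j, r i j ≤ q := fun i j => by
    have := (hr0 i j).trans (mul_le_of_le_one_left hqR.le (hw i j).2)
    exact_mod_cast this
  have hr1 : ∀ i j, |(r i j : ℝ) / q - w i j| ≤ 1 / q := fun i j => by
    have h2 : w i j * q < r i j + 1 := Nat.lt_floor_add_one _
    rw [abs_le, neg_le_sub_iff_le_add, sub_le_iff_le_add, ← add_div, le_div_iff₀ hqR,
      div_le_iff₀ hqR]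
    refine ⟨h2.le, (hr0 i j).trans ?_⟩
    have : (0 : ℝ) < 1 / q := by positivity
    nlinarith
  -- Subtracting the rounded density `r i j / q`, not `w i j`, makes the mean exactly zero.
  let φ : Fin M → Fin M → ZMod q → ℝ := fun i j t => (if t ∈ J (r i j) then 1 else 0) - r i j / q
  have hφsum : ∀ i j, ∑ t, φ i j t = 0 := fun i j => by
    simp only [φ, Finset.sum_sub_distrib, Finset.sum_ite_mem, Finset.univ_inter, Finset.sum_const,
      hJ _ (hr i j), Finset.card_univ, ZMod.card, nsmul_eq_mul, mul_one]
    field_simp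
    ring
  have hφ1 : ∀ i j t, |φ i j t| ≤ 1 := fun i j t => by
    have h1 : (r i j : ℝ) / q ≤ 1 := by
      rw [div_le_one hqR]; exact_mod_cast hr i j
    have h2 : (0 : ℝ) ≤ r i j / q := by positivity
    simp only [φ]
    split_ifs <;> rw [abs_le] <;> constructor <;> linarith
  refine ⟨n, fun x y => planeForm (d x).2 (d y).2 ∈ J (r (d x).1 (d y).1), fun x => (d x).1,
    ?_, ?_, ?_, ?_⟩
  · rw [hcard]; nlinarith [Nat.mul_le_mul hM hq0]
  · intro x y h
    have : r (d y).1 (d x).1 = r (d x).1 (d y).1 := by simp only [r, hsymm]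
    rwa [planeForm_comm, this]
  · intro k
    set δ : Fin M → ℝ := fun i => if i = k then 1 else 0 with hδ
    have h1 := hsumd fun x => δ x.1
    rw [Fintype.sum_prod_type] at h1
    simp only [Finset.sum_const, Finset.card_univ, Fintype.card_prod, ZMod.card, nsmul_eq_mul,
      ← Finset.mul_sum] at h1
    simp only [hδ, Finset.sum_boole, Finset.filter_eq', Finset.mem_univ, if_true,
      Finset.card_singleton, Nat.cast_one, mul_one] at h1
    have h2 : ((Finset.range n).filter fun x => (d x).1 = k).card = q * q := by exact_mod_cast h1
    rw [h2, hcard, mul_comm]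
  · intro a ha1 ha0 f g hf hg
    let f' : X → ℝ := fun x => f (e x)
    let g' : X → ℝ := fun x => g (e x)
    have hd : ∀ x ∈ Finset.range n, (e (d x) : ℕ) = x := fun x hx => by
      simp [d, Fin.ofNat, Nat.mod_eq_of_lt (Finset.mem_range.1 hx)]
    have key : ∑ x ∈ Finset.range n, ∑ y ∈ Finset.range n,
          f x * g y * (a x y - w (d x).1 (d y).1) =
        (∑ x, ∑ y, f' x * g' y * φ x.1 y.1 (planeForm x.2 y.2)) +
        ∑ x, ∑ y, f' x * g' y * (r x.1 y.1 / q - w x.1 y.1) := by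
      simp_rw [← Finset.sum_add_distrib]
      rw [← hsumd]
      refine Finset.sum_congr rfl fun x hx => ?_
      rw [← hsumd]
      refine Finset.sum_congr rfl fun y hy => ?_
      have : a x y = if planeForm (d x).2 (d y).2 ∈ J (r (d x).1 (d y).1) then 1 else 0 := by
        split_ifs with h
        · exact ha1 x y h
        · exact ha0 x y h
      simp only [f', g', hd x hx, hd y hy, φ, this]
      ring
    have hsq := planeForm_kernel_sq_le φ hφsum hφ1 f' g' (fun x => hf _) (fun x => hg _)
    rw [ZMod.card] at hsq
    change _ ≤ (n : ℝ) ^ 4 at hsq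
    have hfirst : |∑ x, ∑ y, f' x * g' y * φ x.1 y.1 (planeForm x.2 y.2)| ≤ ε / 2 * n ^ 2 := by
      refine abs_le_of_sq_le_sq ?_ (by positivity)
      have h2 : (2 / ε) ^ 2 ≤ q := by
        have : 0 < 2 / ε := by positivity
        linarith
      have h3 : 1 ≤ (ε / 2) ^ 2 * q := by
        calc (1 : ℝ) = (ε / 2) ^ 2 * (2 / ε) ^ 2 := by field_simp
          _ ≤ _ := by gcongr
      have h4 : (0 : ℝ) ≤ (n : ℝ) ^ 4 := by positivity
      refine le_of_mul_le_mul_right (hsq.trans ?_) hqR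
      nlinarith
    have hsecond : |∑ x : X, ∑ y : X, f' x * g' y * (r x.1 y.1 / q - w x.1 y.1)| ≤
        ε / 2 * n ^ 2 := by
      have h1 : ∀ x y : X, |f' x * g' y * (r x.1 y.1 / q - w x.1 y.1)| ≤ ε / 2 := by
        intro x y
        rw [abs_mul, abs_mul]
        have h2 : |f' x| * |g' y| ≤ 1 := mul_le_one₀ (hf _) (abs_nonneg _) (hg _)
        refine (mul_le_of_le_one_left (abs_nonneg _) h2).trans ((hr1 _ _).trans ?_)
        rw [div_le_iff₀ hqR]
        have h3 : 2 / ε ≤ q := by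
          have : 0 < (2 / ε) ^ 2 := by positivity
          linarith
        calc (1 : ℝ) = ε / 2 * (2 / ε) := by field_simp
          _ ≤ _ := by gcongr
      calc _ ≤ ∑ x : X, ∑ y : X, |f' x * g' y * (r x.1 y.1 / q - w x.1 y.1)| :=
            (Finset.abs_sum_le_sum_abs _ _).trans
              (Finset.sum_le_sum fun x _ => Finset.abs_sum_le_sum_abs _ _)
        _ ≤ ∑ x : X, ∑ y : X, ε / 2 := by gcongr; exact h1 _ _
        _ = ε / 2 * n ^ 2 := by
          simp only [Finset.sum_const, Finset.card_univ, nsmul_eq_mul, ← hn]; ring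
    rw [key]
    refine (abs_add_le _ _).trans ?_
    linarith

/-! ### Density matrices and kernels with an exceptional class -/

/-- A symmetric matrix of rational edge densities. -/
structure Template where
  size : ℕ
  size_pos : 0 < size
  density : Fin size → Fin size → ℚ
  symm : ∀ i j, density i j = density j i
  mem_Icc : ∀ i j, density i j ∈ Set.Icc (0 : ℚ) 1

instance : Countable Template := by
  let F : Template → Σ n : ℕ, Fin n → Fin n → ℚ := fun t => ⟨t.size, t.density⟩
  refine Function.Injective.countable (f := F) ?_
  rintro ⟨n, _, d, _, _⟩ ⟨n', _, d', _, _⟩ h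
  obtain ⟨rfl, h2⟩ := Sigma.mk.inj_iff.1 h
  obtain rfl := eq_of_heq h2
  rfl

instance : Nonempty Template :=
  ⟨⟨1, one_pos, fun _ _ => 0, fun _ _ => rfl, fun _ _ => by simp⟩⟩

/-- Extension of a kernel by `0` to an additional point. -/
def extendKernel {ι R : Type*} [Zero R] (w : ι → ι → R) : Option ι → Option ι → R
  | some i, some j => w i j
  | _, _ => 0

@[simp] lemma extendKernel_some {ι R : Type*} [Zero R] (w : ι → ι → R) (i j : ι) :
    extendKernel w (some i) (some j) = w i j := rfl

@[simp] lemma extendKernel_none_left {ι R : Type*} [Zero R] (w : ι → ι → R) (i : Option ι) :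
    extendKernel w none i = 0 := rfl

@[simp] lemma extendKernel_none_right {ι R : Type*} [Zero R] (w : ι → ι → R) (i : Option ι) :
    extendKernel w i none = 0 := by cases i <;> rfl

lemma extendKernel_comm {ι R : Type*} [Zero R] {w : ι → ι → R} (hw : ∀ i j, w i j = w j i)
    (i j : Option ι) : extendKernel w i j = extendKernel w j i := by
  cases i <;> cases j <;> simp [hw]

lemma extendKernel_mem_Icc {ι R : Type*} [Field R] [LinearOrder R] [IsStrictOrderedRing R]
    {w : ι → ι → R} (hw : ∀ i j, w i j ∈ Set.Icc (0 : R) 1) (i j : Option ι) :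
    extendKernel w i j ∈ Set.Icc (0 : R) 1 := by
  have h0 : (0 : R) ∈ Set.Icc (0 : R) 1 := ⟨le_rfl, zero_le_one⟩
  rcases i with _ | i
  · exact h0
  · rcases j with _ | j
    · exact h0
    · exact hw i j

/-- This lets an approximation by equally large classes `k` serve a kernel `w` with parts of
arbitrary size: `d` merges classes into parts, and leftover classes become exceptional. -/
lemma extendKernel_bind {ι κ : Type*} (w : ι → ι → ℚ) (d : κ → Option ι) (k l : Option κ) :
    extendKernel (fun k l => ((extendKernel w (d k) (d l) : ℚ) : ℝ)) k l =
      extendKernel (fun i j => (w i j : ℝ)) (k.bind d) (l.bind d) := by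
  rcases k with _ | k
  · rfl
  · rcases l with _ | l
    · simp
    · rcases hk : d k with _ | i
      · simp [hk]
      · rcases hl : d l with _ | j <;> simp [hk, hl]

lemma abs_sub_le_one_of_mem_Icc {a b : ℝ} (ha : a ∈ Set.Icc (0 : ℝ) 1)
    (hb : b ∈ Set.Icc (0 : ℝ) 1) : |a - b| ≤ 1 := by
  rw [abs_le]; constructor <;> linarith [ha.1, ha.2, hb.1, hb.2]

lemma abs_sum_sum_le {α β : Type*} (s : Finset α) (t : Finset β) (F : α → β → ℝ)
    (hF : ∀ x ∈ s, ∀ y ∈ t, |F x y| ≤ 1) :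
    |∑ x ∈ s, ∑ y ∈ t, F x y| ≤ s.card * t.card := by
  calc _ ≤ ∑ x ∈ s, ∑ y ∈ t, |F x y| :=
        (Finset.abs_sum_le_sum_abs _ _).trans
          (Finset.sum_le_sum fun x _ => Finset.abs_sum_le_sum_abs _ _)
    _ ≤ ∑ x ∈ s, ∑ y ∈ t, (1 : ℝ) :=
        Finset.sum_le_sum fun x hx => Finset.sum_le_sum fun y hy => hF x hx y hy
    _ = _ := by simp

/-! ### The universal graph -/

open Classical in
/-- Infinitely many initial segments of the graph `Γ` on `ℕ` are, up to a small error, random-like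
with the densities `w` between equally large classes. -/
def ApproximatesDensities (Γ : SimpleGraph ℕ) {M : ℕ} (w : Fin M → Fin M → ℚ) : Prop :=
  ∀ ε : ℝ, 0 < ε → ∀ N₀ : ℕ, ∃ N, N₀ ≤ N ∧ ∃ c : ℕ → Option (Fin M),
    c 0 = none ∧
    (∀ k, ((Finset.range N).filter fun x => c x = some k).card * M ≤ N) ∧
    (∀ k, (1 - ε) * N ≤ (((Finset.range N).filter fun x => c x = some k).card : ℝ) * M) ∧
    ∀ f g : ℕ → ℝ, (∀ x, |f x| ≤ 1) → (∀ x, |g x| ≤ 1) →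
      |∑ x ∈ Finset.range N, ∑ y ∈ Finset.range N, f x * g y *
        ((if Γ.Adj x y then 1 else 0) - extendKernel (fun i j => (w i j : ℝ)) (c x) (c y))| ≤
        ε * N ^ 2

/-- There is a graph on `ℕ`, in which `0` is adjacent to all other vertices, such that each matrix
of densities is approximated by infinitely many of its initial segments. -/
lemma exists_universal_graph : ∃ Γ : SimpleGraph ℕ, (∀ n, n ≠ 0 → Γ.Adj 0 n) ∧
    ∀ t : Template, ApproximatesDensities Γ t.density := by
  classical
  have hw : ∀ (t : Template) i j, (t.density i j : ℝ) ∈ Set.Icc (0 : ℝ) 1 := fun t i j =>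
    ⟨by exact_mod_cast (t.mem_Icc i j).1, by exact_mod_cast (t.mem_Icc i j).2⟩
  have hblock := fun (t : Template) (n₀ k : ℕ) =>
    exists_quasirandom_relation t.size_pos (fun i j => (t.density i j : ℝ))
      (fun i j => by rw [t.symm]) (hw t) n₀ (ε := 1 / ((k : ℝ) + 1)) (by positivity)
  choose n A c hn hA hc hcut using hblock
  obtain ⟨e, he⟩ := exists_surjective_nat Template
  -- Unpairing makes every template occur at infinitely many `k`.
  let T : ℕ → Template := fun k => e k.unpair.1
  -- The vertices before block `k` are at most a fraction `1 / (k + 1)` of those up to its end.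
  -- Starting at `1` keeps vertex `0` out of all blocks.
  obtain ⟨N, hN0, hN⟩ : ∃ N : ℕ → ℕ, N 0 = 1 ∧
      ∀ k, N (k + 1) = N k + n (T k) ((k + 1) * (N k + 1)) k :=
    ⟨fun k => Nat.rec 1 (fun k N => N + n (T k) ((k + 1) * (N + 1)) k) k, rfl, fun k => rfl⟩
  let b : ℕ → ℕ := fun k => n (T k) ((k + 1) * (N k + 1)) k
  let B : ℕ → ℕ → ℕ → Prop := fun k => A (T k) ((k + 1) * (N k + 1)) k
  let C : ∀ k, ℕ → Fin (T k).size := fun k => c (T k) ((k + 1) * (N k + 1)) k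
  replace hN : ∀ k, N (k + 1) = N k + b k := hN
  have hbk : ∀ k, (k + 1) * (N k + 1) ≤ b k := fun k => hn _ _ _
  have hmono : Monotone N := monotone_nat_of_le_succ fun k => by rw [hN]; omega
  have hN1 : ∀ k, 1 ≤ N k := fun k => hN0 ▸ hmono (Nat.zero_le k)
  let Γ : SimpleGraph ℕ :=
    { Adj := fun x y => x ≠ y ∧ (x = 0 ∨ y = 0 ∨ ∃ k, N k ≤ x ∧ x < N (k + 1) ∧
        N k ≤ y ∧ y < N (k + 1) ∧ B k (x - N k) (y - N k))
      symm := ⟨by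
        rintro x y ⟨hxy, h⟩
        refine ⟨hxy.symm, ?_⟩
        rcases h with h | h | ⟨k, h1, h2, h3, h4, h5⟩
        · exact Or.inr (Or.inl h)
        · exact Or.inl h
        · exact Or.inr (Or.inr ⟨k, h3, h4, h1, h2, hA _ _ _ _ _ h5⟩)⟩
      loopless := ⟨fun x h => h.1 rfl⟩ }
  have hΓ : ∀ k x y, x < b k → y < b k → (Γ.Adj (N k + x) (N k + y) ↔ x ≠ y ∧ B k x y) := by
    intro k x y hx hy
    change (N k + x ≠ N k + y ∧ _) ↔ _
    have hk := hN1 k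
    constructor
    · rintro ⟨hxy, h | h | ⟨l, h1, h2, h3, h4, h5⟩⟩
      · omega
      · omega
      · have hkl : k = l := by
          rcases lt_trichotomy k l with h | h | h
          · have := hmono (Nat.succ_le_of_lt h)
            rw [Nat.succ_eq_add_one, hN] at this
            omega
          · exact h
          · have := hmono (Nat.succ_le_of_lt h)
            rw [Nat.succ_eq_add_one] at this
            omega
        subst hkl
        simp only [Nat.add_sub_cancel_left] at h5
        exact ⟨fun h => hxy (by rw [h]), h5⟩
    · rintro ⟨hxy, h⟩
      refine ⟨by omega, Or.inr (Or.inr ⟨k, by omega, by rw [hN]; omega, by omega,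
        by rw [hN]; omega, ?_⟩)⟩
      simpa only [Nat.add_sub_cancel_left] using h
  refine ⟨Γ, fun m hm => ⟨hm.symm, Or.inl rfl⟩, fun t ε hε N₀ => ?_⟩
  obtain ⟨a, rfl⟩ := he t
  -- The second component only makes `k` large. The error terms add up to at most `3 * N (k + 1) ^ 2
  -- / (k + 1)`, so `4 / ε ≤ k` suffices.
  set k := Nat.pair a (max N₀ ⌈4 / ε⌉₊) with hk
  have hTk : e a = T k := by simp [T, hk]
  have hkN : N₀ ≤ k := (le_max_left _ _).trans (Nat.right_le_pair _ _)
  have hkε : 4 / ε ≤ k := (Nat.le_ceil _).trans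
    (by exact_mod_cast (le_max_right _ _).trans (Nat.right_le_pair _ _))
  clear_value k
  rw [hTk]
  clear hk hTk
  have hkpos : (0 : ℝ) < (k : ℝ) + 1 := by positivity
  have hkε' : 4 / ((k : ℝ) + 1) ≤ ε := by
    rw [div_le_iff₀ hkpos]
    rw [div_le_iff₀ hε] at hkε
    nlinarith
  have hNk : ((k : ℝ) + 1) * (N k + 1) ≤ N (k + 1) := by
    have : (k + 1) * (N k + 1) ≤ N (k + 1) := (hbk k).trans (by rw [hN]; omega)
    exact_mod_cast this
  have hNkpos : (0 : ℝ) < N (k + 1) := by exact_mod_cast hN1 (k + 1)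
  have hNk' : (N k : ℝ) + 1 ≤ 1 / ((k : ℝ) + 1) * N (k + 1) := by
    rw [one_div, ← div_eq_inv_mul, le_div_iff₀ hkpos]; linarith
  let c' : ℕ → Option (Fin (T k).size) := fun x => if x < N k then none else some (C k (x - N k))
  have hcard : ∀ i, ((Finset.range (N (k + 1))).filter fun x => c' x = some i).card *
      (T k).size = b k := by
    intro i
    refine Eq.trans ?_ (hc (T k) ((k + 1) * (N k + 1)) k i)
    congr 1
    symm
    refine Finset.card_bij (fun x _ => N k + x) ?_ ?_ ?_
    · intro x hx
      simp only [Finset.mem_filter, Finset.mem_range] at hx ⊢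
      refine ⟨by rw [hN]; exact Nat.add_lt_add_left hx.1 _, ?_⟩
      simp only [c']
      rw [if_neg (by omega), Nat.add_sub_cancel_left]
      exact congrArg some hx.2
    · intro x _ y _ h
      exact Nat.add_left_cancel h
    · intro y hy
      simp only [Finset.mem_filter, Finset.mem_range, c'] at hy
      obtain ⟨hy1, hy2⟩ := hy
      rw [hN] at hy1
      split_ifs at hy2 with h
      refine ⟨y - N k, ?_, by omega⟩
      simp only [Finset.mem_filter, Finset.mem_range]
      exact ⟨by change _ < b k; omega, Option.some.inj hy2⟩
  refine ⟨N (k + 1), ?_, c', ?_, ?_, ?_, ?_⟩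
  · have := hbk k
    rw [hN]; nlinarith [hN1 k]
  -- The exceptional class must be non-empty because `exists_coupling` normalizes the measure on it;
  -- vertex `0` ensures this.
  · simp only [c']
    rw [if_pos (Nat.lt_of_lt_of_le one_pos (hN1 k))]
  · intro i
    rw [hcard, hN]; omega
  · intro i
    have h1 : (((Finset.range (N (k + 1))).filter fun x => c' x = some i).card : ℝ) *
      (T k).size = b k := by exact_mod_cast hcard i
    have h2 : (N (k + 1) : ℝ) = N k + b k := by exact_mod_cast hN k
    have h3 : 1 / ((k : ℝ) + 1) ≤ ε := le_trans (by gcongr; norm_num) hkε'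
    have h4 := mul_le_mul_of_nonneg_right h3 hNkpos.le
    rw [h1]
    linarith
  · intro f g hf hg
    set w : Fin (T k).size → Fin (T k).size → ℝ := fun i j => ((T k).density i j : ℝ) with hwdef
    set F : ℕ → ℕ → ℝ := fun x y => f x * g y *
      (@ite ℝ (Γ.Adj x y) (Classical.propDecidable _) 1 0 - extendKernel w (c' x) (c' y)) with hF
    have hF1 : ∀ x y, |F x y| ≤ 1 := by
      intro x y
      simp only [hF, abs_mul]
      refine mul_le_one₀ (mul_le_one₀ (hf x) (abs_nonneg _) (hg y)) (abs_nonneg _)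
        (abs_sub_le_one_of_mem_Icc ?_ (extendKernel_mem_Icc (hw _) _ _))
      split_ifs <;> simp
    have hsplit : ∑ x ∈ Finset.range (N (k + 1)), ∑ y ∈ Finset.range (N (k + 1)), F x y =
        ∑ x ∈ Finset.range (N k), ∑ y ∈ Finset.range (N (k + 1)), F x y +
        (∑ x ∈ Finset.range (b k), ∑ y ∈ Finset.range (N k), F (N k + x) y +
        ∑ x ∈ Finset.range (b k), ∑ y ∈ Finset.range (b k), F (N k + x) (N k + y)) := by
      rw [← Finset.sum_add_distrib, hN, Finset.sum_range_add]
      congr 1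
      exact Finset.sum_congr rfl fun x _ => Finset.sum_range_add _ _ _
    -- Inside the block, Γ differs from the quasirandom relation only by the deleted loops, which
    -- cost at most `b k`.
    have hdiag : ∑ x ∈ Finset.range (b k), ∑ y ∈ Finset.range (b k), F (N k + x) (N k + y) =
        ∑ x ∈ Finset.range (b k), ∑ y ∈ Finset.range (b k), f (N k + x) * g (N k + y) *
          ((if B k x y then 1 else 0) - w (C k x) (C k y)) -
        ∑ x ∈ Finset.range (b k), f (N k + x) * g (N k + x) * (if B k x x then 1 else 0) := by
      rw [← Finset.sum_sub_distrib]
      refine Finset.sum_congr rfl fun x hx => ?_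
      have hx' : f (N k + x) * g (N k + x) * (if B k x x then (1 : ℝ) else 0) =
          ∑ y ∈ Finset.range (b k), if x = y then
            f (N k + x) * g (N k + y) * (if B k x y then (1 : ℝ) else 0) else 0 := by
        rw [Finset.sum_ite_eq, if_pos hx]
      rw [hx', ← Finset.sum_sub_distrib]
      refine Finset.sum_congr rfl fun y hy => ?_
      have hcx : ∀ z, c' (N k + z) = some (C k z) := fun z => by
        simp only [c']
        rw [if_neg (by omega), Nat.add_sub_cancel_left]
      simp only [hF, hcx, extendKernel_some,
        hΓ k x y (Finset.mem_range.1 hx) (Finset.mem_range.1 hy)]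
      by_cases hxy : x = y
      · simp only [hxy, ne_eq, not_true_eq_false, false_and, if_false, if_true]; ring
      · simp only [hxy, ne_eq, not_false_eq_true, true_and, if_false]; ring
    have h1 := abs_sum_sum_le (Finset.range (N k)) (Finset.range (N (k + 1))) F
      fun x _ y _ => hF1 x y
    have h2 := abs_sum_sum_le (Finset.range (b k)) (Finset.range (N k))
      (fun x y => F (N k + x) y) fun x _ y _ => hF1 _ y
    have h3 : |∑ x ∈ Finset.range (b k), f (N k + x) * g (N k + x) *
        (if B k x x then (1 : ℝ) else 0)| ≤ b k := by
      refine (Finset.abs_sum_le_sum_abs _ _).trans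
        ((Finset.sum_le_card_nsmul _ _ 1 fun x _ => ?_).trans (by simp))
      rw [abs_mul, abs_mul]
      refine mul_le_one₀ (mul_le_one₀ (hf _) (abs_nonneg _) (hg _)) (abs_nonneg _) ?_
      split_ifs <;> simp
    have h4 := hcut (T k) ((k + 1) * (N k + 1)) k (fun x y => if B k x y then 1 else 0)
      (fun x y h => if_pos h) (fun x y h => if_neg h) (fun x => f (N k + x))
      (fun y => g (N k + y)) (fun x => hf _) (fun y => hg _)
    change |∑ x ∈ Finset.range (b k), ∑ y ∈ Finset.range (b k), f (N k + x) * g (N k + y) *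
          ((if B k x y then 1 else 0) - w (C k x) (C k y))| ≤ 1 / ((k : ℝ) + 1) * (b k) ^ 2 at h4
    change |∑ x ∈ Finset.range (N (k + 1)), ∑ y ∈ Finset.range (N (k + 1)), F x y| ≤ _
    rw [hsplit, hdiag]
    simp only [Finset.card_range] at h1 h2
    have hb : (b k : ℝ) ≤ N (k + 1) := by
      have : b k ≤ N (k + 1) := by rw [hN]; omega
      exact_mod_cast this
    have hb0 : (0 : ℝ) ≤ b k := by positivity
    have h5 : (N k : ℝ) * N (k + 1) + (b k * N k + (1 / ((k : ℝ) + 1) * (b k) ^ 2 + b k)) ≤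
        ε * N (k + 1) ^ 2 := by
      have e1 : (b k : ℝ) * N k + b k ≤ N (k + 1) * (N k + 1) := by
        have : (0 : ℝ) ≤ N k := by positivity
        nlinarith
      have e2 : (N k : ℝ) * N (k + 1) + N (k + 1) * (N k + 1) ≤
          2 * (1 / ((k : ℝ) + 1) * N (k + 1)) * N (k + 1) := by nlinarith
      have e3 : 1 / ((k : ℝ) + 1) * (b k : ℝ) ^ 2 ≤ 1 / ((k : ℝ) + 1) * N (k + 1) ^ 2 := by
        gcongr
      have e4 : 4 * (1 / ((k : ℝ) + 1)) * N (k + 1) ^ 2 ≤ ε * N (k + 1) ^ 2 := by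
        gcongr
        rwa [mul_one_div]
      have e5 : 0 ≤ (1 / ((k : ℝ) + 1)) * (N (k + 1) : ℝ) ^ 2 := by positivity
      nlinarith
    refine le_trans ?_ h5
    refine (abs_add_le _ _).trans (add_le_add h1 ?_)
    refine (abs_add_le _ _).trans (add_le_add h2 ?_)
    exact (abs_sub _ _).trans (add_le_add h4 h3)

/-! ### Edges of initial segments -/

open Classical in
/-- The edges of `Γ` with both endpoints at most `n`. -/
def initialEdges (Γ : SimpleGraph ℕ) (n : ℕ) : Finset (Sym2 ℕ) :=
  (((Finset.range (n + 1)) ×ˢ (Finset.range (n + 1))).filter fun p => Γ.Adj p.1 p.2).image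
    fun p => s(p.1, p.2)

lemma mk_mem_initialEdges {Γ : SimpleGraph ℕ} {n i j : ℕ} :
    s(i, j) ∈ initialEdges Γ n ↔ Γ.Adj i j ∧ i ≤ n ∧ j ≤ n := by
  simp only [initialEdges, Finset.mem_image, Finset.mem_filter, Finset.mem_product,
    Finset.mem_range, Prod.exists]
  constructor
  · rintro ⟨a, b, ⟨⟨ha, hb⟩, hab⟩, h⟩
    rcases Sym2.eq_iff.1 h with ⟨rfl, rfl⟩ | ⟨rfl, rfl⟩
    · exact ⟨hab, by omega, by omega⟩
    · exact ⟨hab.symm, by omega, by omega⟩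
  · rintro ⟨h, hi, hj⟩
    exact ⟨i, j, ⟨⟨by omega, by omega⟩, h⟩, rfl⟩

lemma card_initialEdges_le (Γ : SimpleGraph ℕ) (n : ℕ) :
    (initialEdges Γ n).card ≤ (n + 1) ^ 2 := by
  classical
  refine Finset.card_image_le.trans ((Finset.card_filter_le _ _).trans ?_)
  simp [sq]

lemma not_isDiag_of_mem_initialEdges {Γ : SimpleGraph ℕ} {n : ℕ} {e : Sym2 ℕ}
    (he : e ∈ initialEdges Γ n) : ¬ e.IsDiag := by
  induction e using Sym2.ind with
  | _ i j => exact fun h => (mk_mem_initialEdges.1 he).1.ne (Sym2.mk_isDiag_iff.1 h)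

lemma edges_eq_initialEdges {Γ : SimpleGraph ℕ} {n m : ℕ} {y : ℕ → Sym2 ℕ}
    (h1 : ∀ e ∈ initialEdges Γ n, ∃ i < m, y i = e) (h2 : ∀ i < m, y i ∈ initialEdges Γ n) :
    edges y m = initialEdges Γ n := by
  ext e
  simp only [edges, Finset.mem_filter, Finset.mem_image, Finset.mem_range]
  constructor
  · rintro ⟨⟨i, hi, rfl⟩, -⟩
    exact h2 i hi
  · exact fun he => ⟨h1 e he, not_isDiag_of_mem_initialEdges he⟩

/-! ### A rapidly decaying intensity matrix and its edge law -/

lemma sixteenth_pow_max_le (i j : ℕ) :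
    (1 / 16 : ℝ) ^ max i j ≤ (1 / 4) ^ i * (1 / 4) ^ j := by
  rw [show (1 / 16 : ℝ) = (1 / 4) ^ 2 by norm_num, ← pow_mul, ← pow_add]
  exact pow_le_pow_of_le_one (by norm_num) (by norm_num)
    (by have := le_max_left i j; have := le_max_right i j; omega)

lemma summable_quarter_pow_mul :
    Summable fun p : ℕ × ℕ => (1 / 4 : ℝ) ^ p.1 * (1 / 4) ^ p.2 := by
  have h : Summable fun n : ℕ => (1 / 4 : ℝ) ^ n :=
    summable_geometric_of_lt_one (by norm_num) (by norm_num)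
  exact h.mul_of_nonneg h (fun n => by positivity) (fun n => by positivity)

open Classical in
/-- An intensity matrix for which the edges of `Γ` appear, in essence, in the order of their
larger endpoints. -/
def rapidIntensity (Γ : SimpleGraph ℕ) (hΓ : ∃ i j, Γ.Adj i j) : IntensityMatrix where
  -- With a quadratic exponent, raising the larger endpoint from `n` to `n + 1` costs a factor `16 ^
  -- (2 * n + 1)`, which leaves a long window of time between the two levels.
  val i j := if Γ.Adj i j then (1 / 16) ^ (max i j) ^ 2 else 0
  symm i j := by simp only [Γ.adj_comm, max_comm]
  nonneg i j := by split_ifs <;> positivity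
  summable := by
    refine Summable.of_nonneg_of_le (fun p => ?_) (fun p => ?_) summable_quarter_pow_mul
    · simp only [Function.uncurry]; split_ifs <;> positivity
    · simp only [Function.uncurry]
      split_ifs
      · refine le_trans ?_ (sixteenth_pow_max_le p.1 p.2)
        exact pow_le_pow_of_le_one (by norm_num) (by norm_num) (Nat.le_self_pow two_ne_zero _)
      · positivity
  ne_zero := by
    obtain ⟨i, j, h⟩ := hΓ
    exact ⟨i, j, by rw [if_pos h]; positivity⟩

namespace IntensityMatrix

lemma edgeMeasure_apply (μ : IntensityMatrix) (s : Set (Sym2 ℕ)) :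
    μ.edgeMeasure s = ∑' e, s.indicator (fun e => ENNReal.ofReal (μ.edge e)) e := by
  rw [edgeMeasure, Measure.sum_apply _ (.of_discrete)]
  refine tsum_congr fun e => ?_
  rw [Measure.smul_apply, Measure.dirac_apply, smul_eq_mul]
  by_cases h : e ∈ s <;> simp [h]

/-- Ordered pairs count each non-loop twice, harmless for an upper bound, and turn the sum into one
over `ℕ × ℕ`, where summability is known. -/
lemma edgeMeasure_le (μ : IntensityMatrix) (s : Set (Sym2 ℕ)) :
    μ.edgeMeasure s ≤
      ∑' p : ℕ × ℕ, s.indicator (fun e => ENNReal.ofReal (μ.edge e)) s(p.1, p.2) := by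
  rw [edgeMeasure_apply]
  refine ENNReal.tsum_le_tsum_comp_of_surjective (f := fun p : ℕ × ℕ => s(p.1, p.2)) ?_ _
  intro e
  induction e using Sym2.ind with
  | _ i j => exact ⟨(i, j), rfl⟩

lemma edgeMeasure_singleton (μ : IntensityMatrix) (e : Sym2 ℕ) :
    μ.edgeMeasure {e} = ENNReal.ofReal (μ.edge e) := by
  rw [edgeMeasure_apply, tsum_eq_single e]
  · simp
  · intro e' he'
    simp [he']

lemma edgeMeasure_univ_ne_top (μ : IntensityMatrix) : μ.edgeMeasure Set.univ ≠ ⊤ := by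
  refine ne_top_of_le_ne_top ?_ (μ.edgeMeasure_le _)
  simp only [Set.indicator_univ]
  exact μ.summable.tsum_ofReal_ne_top

lemma edgeMeasure_univ_ne_zero (μ : IntensityMatrix) : μ.edgeMeasure Set.univ ≠ 0 := by
  obtain ⟨i, j, h⟩ := μ.ne_zero
  have h1 : 0 < μ.edgeMeasure {s(i, j)} := by
    rw [edgeMeasure_singleton, ENNReal.ofReal_pos]
    exact lt_of_le_of_ne (μ.nonneg i j) h.symm
  exact (h1.trans_le (measure_mono (Set.subset_univ _))).ne'

instance (μ : IntensityMatrix) : IsProbabilityMeasure μ.edgeLaw :=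
  ⟨by rw [edgeLaw, Measure.smul_apply, smul_eq_mul,
    ENNReal.inv_mul_cancel μ.edgeMeasure_univ_ne_zero μ.edgeMeasure_univ_ne_top]⟩

end IntensityMatrix

/-! ### Borel–Cantelli: almost surely the initial segments are seen -/

lemma one_sub_pow_le_inv {p : ENNReal} (hp : p ≤ 1) (m : ℕ) : (1 - p) ^ m ≤ (m * p)⁻¹ := by
  have hp' : p ≠ ⊤ := ne_top_of_le_ne_top ENNReal.one_ne_top hp
  lift p to NNReal using hp'
  have hp1 : (p : ℝ) ≤ 1 := by exact_mod_cast hp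
  rw [ENNReal.le_inv_iff_mul_le]
  -- Bernoulli gives `m * p ≤ (1 + p) ^ m`, and `(1 - p) * (1 + p) ≤ 1`.
  have h : ((1 - p) ^ m * (m * p) : NNReal) ≤ 1 := by
    rw [← NNReal.coe_le_coe]
    push_cast [NNReal.coe_sub (show p ≤ 1 by exact_mod_cast hp)]
    have h0 : (0 : ℝ) ≤ p := p.2
    have h1 : 1 + m * (p : ℝ) ≤ (1 + p) ^ m := one_add_mul_le_pow (by linarith) m
    have h2 : (0 : ℝ) ≤ (1 - p) ^ m := pow_nonneg (by linarith) m
    calc (1 - (p : ℝ)) ^ m * (m * p) ≤ (1 - (p : ℝ)) ^ m * (1 + p) ^ m := by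
          gcongr; linarith
      _ = (1 - (p : ℝ) ^ 2) ^ m := by rw [← mul_pow]; ring_nf
      _ ≤ 1 := pow_le_one₀ (by nlinarith) (by nlinarith)
  calc (1 - (p : ENNReal)) ^ m * (m * p) = ((1 - p) ^ m * (m * p) : NNReal) := by push_cast; rfl
    _ ≤ 1 := by exact_mod_cast h

/-- The times at which the initial segments of the graph are seen. -/
def rapidTime (n : ℕ) : ℕ := 16 ^ n ^ 2 * 4 ^ n

lemma rapidTime_strictMono : StrictMono rapidTime := by
  refine strictMono_nat_of_lt_succ fun n => ?_
  unfold rapidTime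
  have h1 : 16 ^ n ^ 2 ≤ 16 ^ (n + 1) ^ 2 :=
    Nat.pow_le_pow_right (by norm_num) (Nat.pow_le_pow_left (Nat.le_succ n) 2)
  have h2 : 4 ^ n < 4 ^ (n + 1) := Nat.pow_lt_pow_right (by norm_num) (Nat.lt_succ_self n)
  calc 16 ^ n ^ 2 * 4 ^ n < 16 ^ n ^ 2 * 4 ^ (n + 1) := by gcongr
    _ ≤ _ := by gcongr

section

variable (Γ : SimpleGraph ℕ) (hΓ : ∃ i j, Γ.Adj i j)

lemma rapidIntensity_edge (i j : ℕ) (h : Γ.Adj i j) :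
    (rapidIntensity Γ hΓ).edge s(i, j) = (1 / 16) ^ (max i j) ^ 2 := if_pos h

lemma rapidIntensity_edge_eq_zero (i j : ℕ) (h : ¬ Γ.Adj i j) :
    (rapidIntensity Γ hΓ).edge s(i, j) = 0 := if_neg h

lemma le_rapidIntensity_edge {n : ℕ} {e : Sym2 ℕ} (he : e ∈ initialEdges Γ n) :
    (1 / 16 : ℝ) ^ n ^ 2 ≤ (rapidIntensity Γ hΓ).edge e := by
  induction e using Sym2.ind with
  | _ i j =>
    obtain ⟨h, hi, hj⟩ := mk_mem_initialEdges.1 he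
    rw [rapidIntensity_edge Γ hΓ i j h]
    exact pow_le_pow_of_le_one (by norm_num) (by norm_num)
      (Nat.pow_le_pow_left (max_le hi hj) 2)

/-- Beyond the segment `n < max i j`, so `(max i j) ^ 2 ≥ n ^ 2 + n + max i j`; the last summand is
kept to make the bound summable over all pairs. -/
lemma rapidIntensity_edge_le {n i j : ℕ} (he : s(i, j) ∉ initialEdges Γ n) :
    (rapidIntensity Γ hΓ).edge s(i, j) ≤
      (1 / 16) ^ (n ^ 2 + n) * ((1 / 4) ^ i * (1 / 4) ^ j) := by
  by_cases h : Γ.Adj i j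
  · rw [rapidIntensity_edge Γ hΓ i j h]
    have hmax : n < max i j := by
      rw [mk_mem_initialEdges] at he
      by_contra hle
      exact he ⟨h, (le_max_left i j).trans (not_lt.1 hle), (le_max_right i j).trans (not_lt.1 hle)⟩
    calc (1 / 16 : ℝ) ^ (max i j) ^ 2 ≤ (1 / 16) ^ (n ^ 2 + n + max i j) :=
          pow_le_pow_of_le_one (by norm_num) (by norm_num) (by nlinarith)
      _ = (1 / 16) ^ (n ^ 2 + n) * (1 / 16) ^ max i j := pow_add _ _ _
      _ ≤ _ := by gcongr; exact sixteenth_pow_max_le i j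
  · rw [rapidIntensity_edge_eq_zero Γ hΓ i j h]; positivity

lemma edgeMeasure_compl_initialEdges_le (n : ℕ) :
    (rapidIntensity Γ hΓ).edgeMeasure {e | e ∉ initialEdges Γ n} ≤
      ENNReal.ofReal ((1 / 16) ^ (n ^ 2 + n)) *
        ∑' p : ℕ × ℕ, ENNReal.ofReal ((1 / 4) ^ p.1 * (1 / 4) ^ p.2) := by
  refine ((rapidIntensity Γ hΓ).edgeMeasure_le _).trans ?_
  rw [← ENNReal.tsum_mul_left]
  refine ENNReal.tsum_le_tsum fun p => ?_
  rw [← ENNReal.ofReal_mul (by positivity)]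
  by_cases h : s(p.1, p.2) ∈ initialEdges Γ n
  · rw [Set.indicator_of_notMem (by simpa using h)]; exact zero_le
  · rw [Set.indicator_of_mem (by simpa using h)]
    exact ENNReal.ofReal_le_ofReal (rapidIntensity_edge_le Γ hΓ h)

/-- Almost surely, all but finitely many initial segments of `Γ` are seen. -/
lemma ae_eventually_edges_eq {Ω : Type u} [MeasurableSpace Ω] (P : Measure Ω)
    [IsProbabilityMeasure P] (Y : ℕ → Ω → Sym2 ℕ)
    (hY : ∀ i, HasLaw (Y i) (rapidIntensity Γ hΓ).edgeLaw P) (hind : iIndepFun Y P) :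
    ∀ᵐ ω ∂P, ∀ᶠ n in atTop, edges (fun i => Y i ω) (rapidTime n) = initialEdges Γ n := by
  set μ := rapidIntensity Γ hΓ with hμ
  set Z := μ.edgeMeasure Set.univ with hZ
  have hZ0 : Z ≠ 0 := μ.edgeMeasure_univ_ne_zero
  have hZt : Z ≠ ⊤ := μ.edgeMeasure_univ_ne_top
  set C : ENNReal := ∑' p : ℕ × ℕ, ENNReal.ofReal ((1 / 4) ^ p.1 * (1 / 4) ^ p.2) with hC
  have hCt : C ≠ ⊤ := summable_quarter_pow_mul.tsum_ofReal_ne_top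
  have htime : ∀ n, ((rapidTime n : ℕ) : ENNReal) = ENNReal.ofReal (16 ^ n ^ 2 * 4 ^ n) := by
    intro n
    rw [← ENNReal.ofReal_natCast, rapidTime]; push_cast; rfl
  have hmiss : ∀ n, ∀ e ∈ initialEdges Γ n, P {ω | ∀ i < rapidTime n, Y i ω ≠ e} ≤
      Z * ENNReal.ofReal ((1 / 4) ^ n) := by
    intro n e he
    have h1 : {ω | ∀ i < rapidTime n, Y i ω ≠ e} =
        ⋂ i ∈ Finset.range (rapidTime n), Y i ⁻¹' {e}ᶜ := by
      ext ω; simp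
    have h2 : ∀ i, P (Y i ⁻¹' {e}ᶜ) = 1 - μ.edgeLaw {e} := by
      intro i
      rw [← prob_compl_eq_one_sub (.of_discrete)]
      exact (hY i).measure_eq (p := fun x => x ∈ ({e}ᶜ : Set (Sym2 ℕ))) .of_discrete
    rw [h1, hind.measure_inter_preimage_eq_mul _ fun _ _ => .of_discrete]
    simp only [h2, Finset.prod_const, Finset.card_range]
    refine (one_sub_pow_le_inv prob_le_one _).trans ?_
    -- The expected number of occurrences of `e` is at least `4 ^ n / Z`.
    have h3 : Z⁻¹ * ENNReal.ofReal (4 ^ n) ≤ rapidTime n * μ.edgeLaw {e} := by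
      rw [IntensityMatrix.edgeLaw, Measure.smul_apply, smul_eq_mul,
        IntensityMatrix.edgeMeasure_singleton, mul_left_comm, htime, ← ENNReal.ofReal_mul
        (by positivity)]
      gcongr
      have h4 := le_rapidIntensity_edge Γ hΓ he
      calc (4 : ℝ) ^ n = 16 ^ n ^ 2 * 4 ^ n * (1 / 16) ^ n ^ 2 := by
            rw [one_div, inv_pow]; field_simp
        _ ≤ _ := by gcongr
    refine (ENNReal.inv_le_inv.2 h3).trans ?_
    rw [ENNReal.mul_inv (Or.inl (by simpa using hZt)) (Or.inl (by simpa using hZ0)), inv_inv,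
      ← ENNReal.ofReal_inv_of_pos (by positivity), one_div, inv_pow]
  have hextra : ∀ n, ∀ i, P {ω | Y i ω ∉ initialEdges Γ n} ≤
      Z⁻¹ * (ENNReal.ofReal ((1 / 16) ^ (n ^ 2 + n)) * C) := by
    intro n i
    rw [(hY i).measure_eq (p := fun x => x ∉ initialEdges Γ n) .of_discrete,
      IntensityMatrix.edgeLaw, Measure.smul_apply, smul_eq_mul]
    gcongr
    exact edgeMeasure_compl_initialEdges_le Γ hΓ n
  set bad : ℕ → Set Ω := fun n =>
    {ω | edges (fun i => Y i ω) (rapidTime n) ≠ initialEdges Γ n} with hbad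
  have hsub : ∀ n, bad n ⊆ (⋃ e ∈ initialEdges Γ n, {ω | ∀ i < rapidTime n, Y i ω ≠ e}) ∪
      ⋃ i ∈ Finset.range (rapidTime n), {ω | Y i ω ∉ initialEdges Γ n} := by
    intro n ω hω
    by_contra hcon
    simp only [Set.mem_union, Set.mem_iUnion, Set.mem_ofPred_eq, Finset.mem_range, not_or,
      not_exists, not_forall, not_not] at hcon
    refine hω (edges_eq_initialEdges (fun e he => ?_) hcon.2)
    obtain ⟨i, hi, h⟩ := hcon.1 e he
    exact ⟨i, hi, h⟩
  have hbound : ∀ n, P (bad n) ≤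
      (Z + Z⁻¹ * C) * ENNReal.ofReal (((n : ℝ) + 1) ^ 2 * (1 / 4) ^ n) := by
    intro n
    have h1 : P (⋃ e ∈ initialEdges Γ n, {ω | ∀ i < rapidTime n, Y i ω ≠ e}) ≤
        Z * ENNReal.ofReal (((n : ℝ) + 1) ^ 2 * (1 / 4) ^ n) := by
      refine (measure_biUnion_finset_le _ _).trans ((Finset.sum_le_card_nsmul _ _ _
        (hmiss n)).trans ?_)
      rw [nsmul_eq_mul, mul_left_comm, ENNReal.ofReal_mul (by positivity)]
      gcongr
      rw [← ENNReal.ofReal_natCast]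
      refine ENNReal.ofReal_le_ofReal ?_
      exact_mod_cast card_initialEdges_le Γ n
    have h2 : P (⋃ i ∈ Finset.range (rapidTime n), {ω | Y i ω ∉ initialEdges Γ n}) ≤
        Z⁻¹ * C * ENNReal.ofReal (((n : ℝ) + 1) ^ 2 * (1 / 4) ^ n) := by
      refine (measure_biUnion_finset_le _ _).trans ((Finset.sum_le_card_nsmul _ _ _
        fun i _ => hextra n i).trans ?_)
      rw [nsmul_eq_mul, Finset.card_range, htime]
      -- The number of draws times the mass beyond the segment: `4 ^ n * 16 ^ (-n) = 4 ^ (-n)`.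
      calc ENNReal.ofReal (16 ^ n ^ 2 * 4 ^ n) *
            (Z⁻¹ * (ENNReal.ofReal ((1 / 16) ^ (n ^ 2 + n)) * C))
          = Z⁻¹ * C * (ENNReal.ofReal (16 ^ n ^ 2 * 4 ^ n) *
            ENNReal.ofReal ((1 / 16) ^ (n ^ 2 + n))) := by ring
        _ = Z⁻¹ * C * ENNReal.ofReal ((1 / 4) ^ n) := by
            rw [← ENNReal.ofReal_mul (by positivity)]
            congr 2
            rw [pow_add, show (16 : ℝ) ^ n ^ 2 * 4 ^ n * ((1 / 16) ^ n ^ 2 * (1 / 16) ^ n) =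
              (16 ^ n ^ 2 * (1 / 16) ^ n ^ 2) * (4 ^ n * (1 / 16) ^ n) by ring, ← mul_pow,
              ← mul_pow]
            norm_num
        _ ≤ _ := by
            gcongr
            refine le_mul_of_one_le_left (by positivity) (one_le_pow₀ ?_)
            have : (0 : ℝ) ≤ n := by positivity
            linarith
    rw [add_mul]
    exact (measure_mono (hsub n)).trans ((measure_union_le _ _).trans (add_le_add h1 h2))
  have hsummable : Summable fun n : ℕ => ((n : ℝ) + 1) ^ 2 * (1 / 4) ^ n := by
    have h1 : Summable fun n : ℕ => (n : ℝ) ^ 2 * (1 / 4 : ℝ) ^ n :=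
      summable_pow_mul_geometric_of_norm_lt_one 2 (by norm_num)
    refine (((summable_nat_add_iff 1).2 h1).mul_left 4).congr fun n => ?_
    push_cast
    ring
  have hsum : ∑' n, P (bad n) ≠ ⊤ := by
    refine ne_top_of_le_ne_top ?_ (ENNReal.tsum_le_tsum hbound)
    rw [ENNReal.tsum_mul_left]
    exact ENNReal.mul_ne_top (ENNReal.add_ne_top.2
      ⟨hZt, ENNReal.mul_ne_top (ENNReal.inv_ne_top.2 hZ0) hCt⟩) hsummable.tsum_ofReal_ne_top
  filter_upwards [ae_eventually_notMem hsum] with ω hω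
  filter_upwards [hω] with n hn
  simpa [hbad] using hn

end

/-! ### Approximation of graphons by step functions -/

/-- The function `F` on `S × S` is a limit in `L¹` of step functions, that is, functions that are
constant on the products of the parts of a finite measurable partition of `S`. -/
def IsStepLimit {S : Type v} [MeasurableSpace S] (ν : Measure S) (F : S × S → ℝ) : Prop :=
  ∀ ε : ENNReal, ε ≠ 0 → ∃ (n : ℕ) (π : S → Fin n) (w : Fin n → Fin n → ℝ), Measurable π ∧
    eLpNorm (fun z => F z - w (π z.1) (π z.2)) 1 (ν.prod ν) ≤ ε

lemma measurable_step {S ι : Type*} [MeasurableSpace S] [Countable ι] [MeasurableSpace ι]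
    [DiscreteMeasurableSpace ι] {π : S → ι} (hπ : Measurable π) (w : ι → ι → ℝ) :
    Measurable fun z : S × S => w (π z.1) (π z.2) :=
  (Measurable.of_discrete (f := Function.uncurry w)).comp
    ((hπ.comp measurable_fst).prodMk (hπ.comp measurable_snd))

namespace IsStepLimit

variable {S : Type v} [MeasurableSpace S] {ν : Measure S}

/-- Allowing any finite index type lets common refinements be indexed by products, as in `add`. -/
lemma of_step {ι : Type*} [Fintype ι] [MeasurableSpace ι] [DiscreteMeasurableSpace ι]
    {π : S → ι} (hπ : Measurable π) (w : ι → ι → ℝ) :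
    IsStepLimit ν fun z => w (π z.1) (π z.2) := by
  intro ε _
  refine ⟨Fintype.card ι, fun x => Fintype.equivFin ι (π x),
    fun i j => w ((Fintype.equivFin ι).symm i) ((Fintype.equivFin ι).symm j),
    (Measurable.of_discrete (f := Fintype.equivFin ι)).comp hπ, ?_⟩
  simp

lemma of_forall_approx {F : S × S → ℝ} (hF : Measurable F)
    (h : ∀ ε : ENNReal, ε ≠ 0 → ∃ G : S × S → ℝ, Measurable G ∧ IsStepLimit ν G ∧
      eLpNorm (fun z => F z - G z) 1 (ν.prod ν) ≤ ε) : IsStepLimit ν F := by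
  intro ε hε
  have hε2 : ε / 2 ≠ 0 := (ENNReal.half_pos hε).ne'
  obtain ⟨G, hG, hGs, hFG⟩ := h (ε / 2) hε2
  obtain ⟨n, π, w, hπ, hw⟩ := hGs (ε / 2) hε2
  refine ⟨n, π, w, hπ, ?_⟩
  have : (fun z : S × S => F z - w (π z.1) (π z.2)) =
      (fun z => F z - G z) + fun z => G z - w (π z.1) (π z.2) := by
    ext z; simp
  rw [this]
  refine (eLpNorm_add_le (hF.sub hG).aestronglyMeasurable
    (hG.sub (measurable_step hπ w)).aestronglyMeasurable le_rfl).trans ?_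
  exact (add_le_add hFG hw).trans (ENNReal.add_halves ε).le

lemma add {F G : S × S → ℝ} (hF : Measurable F) (hG : Measurable G) (hFs : IsStepLimit ν F)
    (hGs : IsStepLimit ν G) : IsStepLimit ν fun z => F z + G z := by
  refine of_forall_approx (hF.add hG) fun ε hε => ?_
  have hε2 : ε / 2 ≠ 0 := (ENNReal.half_pos hε).ne'
  obtain ⟨n, π, w, hπ, hw⟩ := hFs (ε / 2) hε2
  obtain ⟨n', π', w', hπ', hw'⟩ := hGs (ε / 2) hε2
  refine ⟨fun z => w (π z.1) (π z.2) + w' (π' z.1) (π' z.2),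
    (measurable_step hπ w).add (measurable_step hπ' w'),
    of_step (hπ.prodMk hπ') fun i j => w i.1 j.1 + w' i.2 j.2, ?_⟩
  have : (fun z : S × S => F z + G z - (w (π z.1) (π z.2) + w' (π' z.1) (π' z.2))) =
      (fun z => F z - w (π z.1) (π z.2)) + fun z => G z - w' (π' z.1) (π' z.2) := by
    ext z; simp only [Pi.add_apply]; ring
  rw [this]
  refine (eLpNorm_add_le (hF.sub (measurable_step hπ w)).aestronglyMeasurable
    (hG.sub (measurable_step hπ' w')).aestronglyMeasurable le_rfl).trans ?_
  exact (add_le_add hw hw').trans (ENNReal.add_halves ε).le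

lemma const_mul {F : S × S → ℝ} (hFs : IsStepLimit ν F) (c : ℝ) :
    IsStepLimit ν fun z => c * F z := by
  -- For `c = 0` the tolerance `ε / ‖c‖ₑ` is `⊤`, and the final estimate still holds.
  intro ε hε
  obtain ⟨n, π, w, hπ, hw⟩ := hFs (ε / ‖c‖ₑ) (ENNReal.div_pos hε (by simp)).ne'
  refine ⟨n, π, fun i j => c * w i j, hπ, ?_⟩
  have : (fun z : S × S => c * F z - c * w (π z.1) (π z.2)) =
      c • fun z => F z - w (π z.1) (π z.2) := by
    ext z; simp only [Pi.smul_apply, smul_eq_mul]; ring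
  rw [this, eLpNorm_const_smul]
  exact (mul_le_mul_right hw _).trans ENNReal.mul_div_le

lemma sum {κ : Type*} (s : Finset κ) {F : κ → S × S → ℝ} (hF : ∀ k, Measurable (F k))
    (hFs : ∀ k, IsStepLimit ν (F k)) : IsStepLimit ν fun z => ∑ k ∈ s, F k z := by
  classical
  induction s using Finset.induction_on with
  | empty => simpa using of_step (ν := ν) (measurable_const (a := ())) fun _ _ => 0
  | insert k s hk ih =>
    simp only [Finset.sum_insert hk]
    exact add (hF k) (Finset.measurable_fun_sum s fun i _ => hF i) (hFs k) ih

/-- A π-λ argument: rectangles are steps, complements are differences from `1`, and in a disjoint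
union the tail has measure tending to `0`. -/
lemma indicator [IsProbabilityMeasure ν] {E : Set (S × S)} (hE : MeasurableSet E) :
    IsStepLimit ν (E.indicator fun _ => 1) := by
  classical
  induction E, hE using MeasurableSpace.induction_on_inter generateFrom_prod.symm
    isPiSystem_prod with
  | empty => simpa using of_step (ν := ν) (measurable_const (a := ())) fun _ _ => 0
  | basic E hE =>
    obtain ⟨A, hA, B, hB, rfl⟩ := hE
    have hπ : Measurable fun x : S => ((x ∈ A : Prop), (x ∈ B : Prop)) :=
      (measurableSet_setOfPred.1 hA).prodMk (measurableSet_setOfPred.1 hB)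
    convert of_step (ν := ν) hπ fun i j => if i.1 ∧ j.2 then 1 else 0 using 2 with z
    simp [Set.indicator, Set.mem_prod]
  | compl E hE ih =>
    have h1 : IsStepLimit ν fun _ => (1 : ℝ) :=
      of_step (ν := ν) (measurable_const (a := ())) fun _ _ => 1
    have hm : Measurable (E.indicator fun _ => (1 : ℝ)) := measurable_const.indicator hE
    convert add measurable_const (hm.const_mul (-1)) h1 (ih.const_mul (-1)) using 2 with z
    by_cases hz : z ∈ E <;> simp [hz]
  | iUnion f hd hf ih =>
    have hm : ∀ i, Measurable ((f i).indicator fun _ => (1 : ℝ)) := fun i =>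
      measurable_const.indicator (hf i)
    refine of_forall_approx (measurable_const.indicator (.iUnion hf)) fun ε hε => ?_
    have htail := tendsto_measure_biUnion_Ici_zero_of_pairwise_disjoint (μ := ν.prod ν)
      (fun i => (hf i).nullMeasurableSet) hd
    obtain ⟨N, hN⟩ := ((ENNReal.tendsto_nhds_zero.1 htail) ε (pos_iff_ne_zero.2 hε)).exists
    refine ⟨fun z => ∑ i ∈ Finset.range N, (f i).indicator (fun _ => 1) z,
      Finset.measurable_fun_sum _ fun i _ => hm i, sum _ hm ih, ?_⟩
    rw [eLpNorm_one_eq_lintegral_enorm]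
    refine le_trans ?_ hN
    have hmT : MeasurableSet (⋃ i ≥ N, f i) := .iUnion fun i => .iUnion fun _ => hf i
    rw [Function.comp_apply, ← lintegral_indicator_one hmT]
    refine lintegral_mono fun z => ?_
    beta_reduce
    by_cases hz : ∃ j, z ∈ f j
    · obtain ⟨j, hj⟩ := hz
      have hother : ∀ i, i ≠ j → z ∉ f i := fun i hij hi =>
        Set.disjoint_left.1 (hd hij) hi hj
      have hU : z ∈ ⋃ i, f i := Set.mem_iUnion.2 ⟨j, hj⟩
      by_cases hjN : j < N
      · rw [Set.indicator_of_mem hU, Finset.sum_eq_single_of_mem j (Finset.mem_range.2 hjN)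
          fun i _ hij => Set.indicator_of_notMem (hother i hij) _, Set.indicator_of_mem hj]
        simp
      · rw [Set.indicator_of_mem hU, Finset.sum_eq_zero fun i hi =>
          Set.indicator_of_notMem (hother i fun h => hjN (h ▸ Finset.mem_range.1 hi)) _,
          Set.indicator_of_mem (s := ⋃ i ≥ N, f i)
            (Set.mem_iUnion₂.2 ⟨j, not_lt.1 hjN, hj⟩)]
        simp
    · push Not at hz
      rw [Set.indicator_of_notMem (by simpa using hz),
        Finset.sum_eq_zero fun i _ => Set.indicator_of_notMem (hz i) _]
      simp

lemma of_integrable [IsProbabilityMeasure ν] {F : S × S → ℝ} (hF : Measurable F)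
    (hint : Integrable F (ν.prod ν)) : IsStepLimit ν F := by
  refine of_forall_approx hF fun ε hε => ?_
  obtain ⟨g, hg, -⟩ := (memLp_one_iff_integrable.2 hint).exists_simpleFunc_eLpNorm_sub_lt
    ENNReal.one_ne_top hε
  refine ⟨g, g.measurable, ?_, hg.le⟩
  clear hg
  induction g using SimpleFunc.induction with
  | const c hs =>
    convert (indicator (ν := ν) hs).const_mul c using 2 with z
    simp [Set.indicator, Set.piecewise]
  | add _ hf hg =>
    exact add (SimpleFunc.measurable _) (SimpleFunc.measurable _) hf hg

end IsStepLimit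

/-- A graphon is approximated in `L¹` by step graphons with rational values. -/
lemma Graphon.exists_step_approx {S : Type v} [MeasurableSpace S] (ν : Measure S)
    [IsProbabilityMeasure ν] (W : Graphon S) {ε : ℝ} (hε : 0 < ε) :
    ∃ (n : ℕ) (π : S → Fin n) (w : Fin n → Fin n → ℚ), Measurable π ∧
      (∀ i j, w i j = w j i) ∧ (∀ i j, w i j ∈ Set.Icc (0 : ℚ) 1) ∧
      ∫ z, |W.toFun z.1 z.2 - w (π z.1) (π z.2)| ∂(ν.prod ν) ≤ ε := by
  have hWm : Measurable fun z : S × S => W.toFun z.1 z.2 := W.measurable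
  have hWi : Integrable (fun z : S × S => W.toFun z.1 z.2) (ν.prod ν) := by
    refine Integrable.of_bound hWm.aestronglyMeasurable 1 (ae_of_all _ fun z => ?_)
    rw [Real.norm_eq_abs, abs_le]
    constructor <;> linarith [(W.mem_Icc z.1 z.2).1, (W.mem_Icc z.1 z.2).2]
  obtain ⟨n, π, w, hπ, hw⟩ := IsStepLimit.of_integrable hWm hWi (ENNReal.ofReal (ε / 2))
    (by simpa using hε)
  have hq : ∀ i j, ∃ q : ℚ, |(q : ℝ) - w i j| ≤ ε / 2 := fun i j => by
    obtain ⟨q, h1, h2⟩ := exists_rat_btwn (show w i j < w i j + ε / 2 by linarith)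
    exact ⟨q, by rw [abs_le]; constructor <;> linarith⟩
  choose q hq using hq
  set D : S × S → ℝ := fun z => W.toFun z.1 z.2 - w (π z.1) (π z.2) with hD
  have hDm : Measurable D := hWm.sub (measurable_step hπ w)
  have hDlt : eLpNorm D 1 (ν.prod ν) < ⊤ := hw.trans_lt ENNReal.ofReal_lt_top
  have hDi : Integrable D (ν.prod ν) :=
    memLp_one_iff_integrable.1 ⟨hDm.aestronglyMeasurable, hDlt⟩
  have hDint : ∫ z, |D z| ∂(ν.prod ν) ≤ ε / 2 := by
    have h1 : ENNReal.ofReal (∫ z, ‖D z‖ ∂(ν.prod ν)) ≤ ENNReal.ofReal (ε / 2) := by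
      rw [ofReal_integral_norm_eq_lintegral_enorm hDi, ← eLpNorm_one_eq_lintegral_enorm]
      exact hw
    exact (ENNReal.ofReal_le_ofReal_iff (by positivity)).1 h1
  have hswap : ∫ z : S × S, |D z.swap| ∂(ν.prod ν) = ∫ z, |D z| ∂(ν.prod ν) :=
    (Measure.measurePreserving_swap (μ := ν) (ν := ν)).integral_comp
      MeasurableEquiv.prodComm.measurableEmbedding fun z => |D z|
  have hDsi : Integrable (fun z : S × S => |D z.swap|) (ν.prod ν) :=
    (hDi.swap).abs
  -- Averaging with the transpose restores symmetry and clipping restores the range. Neither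
  -- increases the L¹ error bound, as `W` is symmetric with values in `[0, 1]`.
  refine ⟨n, π, fun i j => max 0 (min 1 ((q i j + q j i) / 2)), hπ, fun i j => by
      simp only [add_comm],
    fun i j => ⟨le_max_left _ _, max_le zero_le_one (min_le_left _ _)⟩, ?_⟩
  have hpt : ∀ z : S × S,
      |W.toFun z.1 z.2 - ((max 0 (min 1 ((q (π z.1) (π z.2) + q (π z.2) (π z.1)) / 2)) : ℚ) : ℝ)| ≤
        (|D z| + |D z.swap|) / 2 + ε / 2 := by
    rintro ⟨x, y⟩
    obtain ⟨h0, h1⟩ := W.mem_Icc x y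
    have e1 := hq (π x) (π y)
    have e2 := hq (π y) (π x)
    have e3 : D (x, y) = W.toFun x y - w (π x) (π y) := rfl
    have e4 : D (Prod.swap (x, y)) = W.toFun x y - w (π y) (π x) := by
      rw [W.symm x y]; rfl
    rw [e3, e4]
    push_cast
    set a := (q (π x) (π y) : ℝ)
    set b := (q (π y) (π x) : ℝ)
    have e5 : |W.toFun x y - max 0 (min 1 ((a + b) / 2))| ≤ |W.toFun x y - (a + b) / 2| := by
      rcases le_total ((a + b) / 2) 0 with h | h
      · rw [min_eq_right (by linarith), max_eq_left h, abs_of_nonneg (by linarith),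
          abs_of_nonneg (by linarith)]
        linarith
      · rcases le_total ((a + b) / 2) 1 with h' | h'
        · rw [min_eq_right h', max_eq_right h]
        · rw [min_eq_left h', max_eq_right zero_le_one, abs_of_nonpos (by linarith),
            abs_of_nonpos (by linarith)]
          linarith
    refine e5.trans ?_
    have e6 : W.toFun x y - (a + b) / 2 = ((W.toFun x y - w (π x) (π y)) +
        (W.toFun x y - w (π y) (π x)) - (a - w (π x) (π y)) - (b - w (π y) (π x))) / 2 := by ring
    rw [e6, abs_div, abs_two]
    have e7 := abs_sub ((W.toFun x y - w (π x) (π y)) +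
        (W.toFun x y - w (π y) (π x)) - (a - w (π x) (π y))) (b - w (π y) (π x))
    have e8 := abs_sub ((W.toFun x y - w (π x) (π y)) +
        (W.toFun x y - w (π y) (π x))) (a - w (π x) (π y))
    have e9 := abs_add_le (W.toFun x y - w (π x) (π y)) (W.toFun x y - w (π y) (π x))
    linarith
  have hsi : Integrable (fun z : S × S => (|D z| + |D z.swap|) / 2) (ν.prod ν) :=
    (hDi.abs.add hDsi).div_const 2
  have hbi : Integrable (fun z : S × S => (|D z| + |D z.swap|) / 2 + ε / 2) (ν.prod ν) :=
    hsi.add (integrable_const _)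
  refine (integral_mono_of_nonneg (ae_of_all _ fun z => abs_nonneg _) hbi
    (ae_of_all _ hpt)).trans ?_
  rw [integral_add hsi (integrable_const _), integral_div,
    integral_add hDi.abs hDsi, hswap, integral_const, probReal_univ, one_smul]
  linarith

/-! ### Coupling the vertices with the probability space -/

lemma measure_inter_fibers_sum {α κ : Type*} [MeasurableSpace α] (u : Measure α) [Fintype κ]
    (c : α → κ) (hc : ∀ k, MeasurableSet (c ⁻¹' {k})) (s : Set α) :
    ∑ k, u (s ∩ c ⁻¹' {k}) = u s := by
  have h := sum_measure_preimage_singleton (μ := u.restrict s) (f := c) Finset.univ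
    fun k _ => hc k
  simp only [Measure.restrict_apply (hc _), Finset.coe_univ, Set.preimage_univ,
    Measure.restrict_apply_univ] at h
  simpa only [Set.inter_comm] using h

/-- A coupling of two probability measures under which the classes agree whenever the first
point has a class. -/
lemma exists_coupling {V : Type u} {S : Type v} [MeasurableSpace V] [DiscreteMeasurableSpace V]
    [MeasurableSpace S] (u : Measure V) [IsProbabilityMeasure u] (ν : Measure S)
    [IsProbabilityMeasure ν] {ι : Type*} [Fintype ι] (c : V → Option ι) (π : S → ι)
    (hπ : ∀ i, MeasurableSet (π ⁻¹' {i})) (hle : ∀ i, u (c ⁻¹' {some i}) ≤ ν (π ⁻¹' {i}))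
    (hnone : u (c ⁻¹' {none}) ≠ 0) :
    ∃ P : Measure (V × S), IsProbabilityMeasure P ∧ MeasurePreserving Prod.fst P u ∧
      MeasurePreserving Prod.snd P ν ∧
      P {z | c z.1 ≠ some (π z.2)} ≤ u (c ⁻¹' {none}) := by
  classical
  set A : ι → Set V := fun i => c ⁻¹' {some i} with hA
  set A₀ : Set V := c ⁻¹' {none} with hA₀
  set B : ι → Set S := fun i => π ⁻¹' {i} with hB
  -- What remains of `ν` once each class `A i` has been spread over its part `B i`; its mass is `u
  -- A₀`, and the exceptional points are spread over it.
  set γ : Measure S := ∑ i, (ν (B i) - u (A i)) • ν[|B i] with hγ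
  set P : Measure (V × S) := (∑ i, (u.restrict (A i)).prod (ν[|B i])) +
    ((u A₀)⁻¹ • u.restrict A₀).prod γ with hP
  replace hle : ∀ i, u (A i) ≤ ν (B i) := hle
  have hA₀t : u A₀ ≠ ⊤ := measure_ne_top _ _
  have : IsFiniteMeasure γ := ⟨by
    simp only [hγ, Measure.finsetSum_apply, Measure.smul_apply, smul_eq_mul]
    exact ENNReal.sum_lt_top.2 fun i _ => ENNReal.mul_lt_top
      (tsub_le_self.trans_lt (measure_lt_top _ _)) (measure_lt_top _ _)⟩
  have hrect : ∀ (s : Set V) (t : Set S), P (s ×ˢ t) = ∑ i, u (s ∩ A i) * ν[t | B i] +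
      (u A₀)⁻¹ * u (s ∩ A₀) * ∑ i, (ν (B i) - u (A i)) * ν[t | B i] := by
    intro s t
    simp only [hP, Measure.add_apply, Measure.finsetSum_apply, Measure.prod_prod,
      Measure.smul_apply, smul_eq_mul, Measure.restrict_apply (MeasurableSet.of_discrete (s := s))]
    simp only [hγ, Measure.finsetSum_apply, Measure.smul_apply, smul_eq_mul]
  -- If `ν (B i) = 0`, the conditional measure is zero, but then so is `a`.
  have hcond : ∀ i (a : ENNReal), a ≤ ν (B i) → a * ν[Set.univ | B i] = a := by
    intro i a ha
    by_cases h : ν (B i) = 0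
    · rw [h, nonpos_iff_eq_zero] at ha
      rw [ha, zero_mul]
    · have := cond_isProbabilityMeasure h
      rw [measure_univ, mul_one]
  have hu : ∀ s : Set V, ∑ i, u (s ∩ A i) + u (s ∩ A₀) = u s := by
    intro s
    rw [← measure_inter_fibers_sum u c (fun _ => .of_discrete) s, Fintype.sum_option, add_comm]
  have hν : ∀ t : Set S, ∑ i, ν (B i) * ν[t | B i] = ν t := by
    intro t
    rw [← measure_inter_fibers_sum ν π hπ t]
    refine Finset.sum_congr rfl fun i _ => ?_
    rw [mul_comm, cond_mul_eq_inter (hπ i), Set.inter_comm]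
  have hrest : ∑ i, (ν (B i) - u (A i)) = u A₀ := by
    have h1 : ∑ i, (ν (B i) - u (A i)) + ∑ i, u (A i) = 1 := by
      rw [← Finset.sum_add_distrib]
      simp only [tsub_add_cancel_of_le (hle _)]
      have := measure_inter_fibers_sum ν π hπ Set.univ
      simpa only [Set.univ_inter, measure_univ] using this
    have h2 : u A₀ + ∑ i, u (A i) = 1 := by
      have := hu Set.univ
      rw [add_comm]
      simpa only [Set.univ_inter, measure_univ] using this
    refine (ENNReal.add_left_inj ?_).1 (h1.trans h2.symm)
    exact (ENNReal.sum_lt_top.2 fun i _ => measure_lt_top _ _).ne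
  have hfst : ∀ s : Set V, P (Prod.fst ⁻¹' s) = u s := by
    intro s
    rw [← Set.prod_univ, hrect]
    have h1 : ∀ i, u (s ∩ A i) * ν[Set.univ | B i] = u (s ∩ A i) := fun i =>
      hcond i _ ((measure_mono Set.inter_subset_right).trans (hle i))
    simp only [h1, hcond _ _ tsub_le_self, hrest]
    rw [mul_right_comm, ENNReal.inv_mul_cancel hnone hA₀t, one_mul, hu]
  have hsnd : ∀ t : Set S, P (Prod.snd ⁻¹' t) = ν t := by
    intro t
    rw [← Set.univ_prod, hrect]
    simp only [Set.univ_inter]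
    rw [ENNReal.inv_mul_cancel hnone hA₀t, one_mul, ← Finset.sum_add_distrib, ← hν t]
    refine Finset.sum_congr rfl fun i _ => ?_
    rw [← add_mul, add_tsub_cancel_of_le (hle i)]
  refine ⟨P, ⟨?_⟩, ⟨measurable_fst, ?_⟩, ⟨measurable_snd, ?_⟩, ?_⟩
  · rw [← Set.preimage_univ (f := Prod.fst), hfst, measure_univ]
  · ext s hs
    rw [Measure.map_apply measurable_fst hs, hfst]
  · ext t ht
    rw [Measure.map_apply measurable_snd ht, hsnd]
  · have hsub : {z : V × S | c z.1 ≠ some (π z.2)} ⊆ Prod.fst ⁻¹' A₀ ∪ ⋃ i, A i ×ˢ (B i)ᶜ := by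
      rintro ⟨x, y⟩ hz
      change c x ≠ some (π y) at hz
      rcases hcx : c x with _ | i
      · exact Or.inl hcx
      · refine Or.inr (Set.mem_iUnion.2 ⟨i, hcx, fun h => hz ?_⟩)
        rw [hcx]
        exact congrArg some (Eq.symm h)
    have hzero : ∀ i, P (A i ×ˢ (B i)ᶜ) = 0 := by
      intro i
      have h0 : A i ∩ A₀ = ∅ := by
        ext x
        simp only [hA, hA₀, Set.mem_inter_iff, Set.mem_preimage, Set.mem_singleton_iff,
          Set.mem_empty_iff_false, iff_false, not_and]
        intro h; simp [h]
      rw [hrect, h0, measure_empty, mul_zero, zero_mul, add_zero]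
      refine Finset.sum_eq_zero fun j _ => ?_
      by_cases hij : i = j
      · subst hij
        rw [cond_apply (hπ i), Set.inter_compl_self, measure_empty, mul_zero, mul_zero]
      · have h1 : A i ∩ A j = ∅ := by
          ext x
          simp only [hA, Set.mem_inter_iff, Set.mem_preimage, Set.mem_singleton_iff,
            Set.mem_empty_iff_false, iff_false, not_and]
          intro h; simp [h, hij]
        rw [h1, measure_empty, zero_mul]
    refine (measure_mono hsub).trans ((measure_union_le _ _).trans ?_)
    rw [hfst, measure_iUnion_null hzero, add_zero]

/-! ### Cut distance between a graph and a graphon -/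

/-- The integral over a rectangle of a function that factors through a finite set. -/
lemma setIntegral_prod_finite {Ω : Type*} {V : Type*} [MeasurableSpace Ω] [Fintype V]
    [MeasurableSpace V] [DiscreteMeasurableSpace V] (P : Measure Ω) [IsFiniteMeasure P]
    {φ : Ω → V} (hφ : Measurable φ) (F : V → V → ℝ) (T U : Set Ω) :
    ∫ z in T ×ˢ U, F (φ z.1) (φ z.2) ∂(P.prod P) =
      ∑ x, ∑ y, P.real (T ∩ φ ⁻¹' {x}) * P.real (U ∩ φ ⁻¹' {y}) * F x y := by
  have hφ2 : Measurable (Prod.map φ φ) := hφ.prodMap hφ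
  have h1 : ∫ z in T ×ˢ U, F (φ z.1) (φ z.2) ∂(P.prod P) =
      ∫ p, Function.uncurry F p ∂(((P.prod P).restrict (T ×ˢ U)).map (Prod.map φ φ)) := by
    rw [integral_map hφ2.aemeasurable (Measurable.of_discrete).aestronglyMeasurable]
    rfl
  rw [h1, integral_fintype (.of_finite), Fintype.sum_prod_type]
  refine Finset.sum_congr rfl fun x _ => Finset.sum_congr rfl fun y _ => ?_
  have h2 : Prod.map φ φ ⁻¹' {(x, y)} ∩ T ×ˢ U = (T ∩ φ ⁻¹' {x}) ×ˢ (U ∩ φ ⁻¹' {y}) := by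
    ext z
    simp only [Set.mem_inter_iff, Set.mem_preimage, Set.mem_prod, Set.mem_singleton_iff,
      Prod.map, Prod.mk.injEq]
    tauto
  rw [map_measureReal_apply hφ2 (.of_discrete), measureReal_restrict_apply
    (hφ2 (.of_discrete)), h2, measureReal_prod_prod, smul_eq_mul]
  rfl

lemma integrable_of_abs_le_one {Ω : Type*} [MeasurableSpace Ω] {μ : Measure Ω}
    [IsFiniteMeasure μ] {F : Ω → ℝ} (hF : Measurable F) (h : ∀ z, |F z| ≤ 1) : Integrable F μ :=
  Integrable.of_bound hF.aestronglyMeasurable 1 (ae_of_all _ h)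

lemma abs_setIntegral_le {Ω : Type*} [MeasurableSpace Ω] {μ : Measure Ω} {F : Ω → ℝ}
    (hF : Integrable F μ) (R : Set Ω) : |∫ z in R, F z ∂μ| ≤ ∫ z, |F z| ∂μ :=
  (abs_integral_le_integral_abs).trans
    (setIntegral_le_integral hF.abs (ae_of_all _ fun _ => abs_nonneg _))

lemma cutNorm_nonneg {Ω : Type u} [MeasurableSpace Ω] (P : Measure Ω) (F : Ω → Ω → ℝ) :
    0 ≤ cutNorm P F :=
  Real.sSup_nonneg fun r hr => by
    obtain ⟨T, U, -, -, rfl⟩ := hr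
    exact abs_nonneg _

lemma cutDist_nonneg {Ω₁ : Type u} {Ω₂ : Type v} [MeasurableSpace Ω₁] [MeasurableSpace Ω₂]
    (P₁ : Measure Ω₁) (W₁ : Graphon Ω₁) (P₂ : Measure Ω₂) (W₂ : Graphon Ω₂) :
    0 ≤ cutDist P₁ W₁ P₂ W₂ :=
  Real.sInf_nonneg fun r hr => by
    obtain ⟨Ω, _, P, φ₁, φ₂, -, -, -, rfl⟩ := hr
    exact cutNorm_nonneg _ _

open Classical in
/-- A graph is close to a graphon if both are close to the same step function. -/
lemma cutDistGraph_le {V : Type} [Fintype V] [MeasurableSpace V] [DiscreteMeasurableSpace V]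
    (G : SimpleGraph V) {S : Type v} [MeasurableSpace S] (ν : Measure S) [IsProbabilityMeasure ν]
    (W : Graphon S) {ι : Type} [Fintype ι] [MeasurableSpace ι] [DiscreteMeasurableSpace ι]
    (c : V → Option ι) {π : S → ι} (hπ : Measurable π) {w : ι → ι → ℝ}
    (hw : ∀ i j, w i j ∈ Set.Icc (0 : ℝ) 1) {η κ δ : ℝ}
    (hcut : ∀ f g : V → ℝ, (∀ x, |f x| ≤ 1) → (∀ x, |g x| ≤ 1) →
      |∑ x, ∑ y, f x * g y * ((if G.Adj x y then 1 else 0) - extendKernel w (c x) (c y))| ≤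
        η * (Fintype.card V : ℝ) ^ 2)
    (hL1 : ∫ z, |W.toFun z.1 z.2 - w (π z.1) (π z.2)| ∂(ν.prod ν) ≤ δ)
    (hle : ∀ i, (uniformOn (Set.univ : Set V)).real (c ⁻¹' {some i}) ≤ ν.real (π ⁻¹' {i}))
    (hnone : ∃ v, c v = none) (hκ : (uniformOn (Set.univ : Set V)).real (c ⁻¹' {none}) ≤ κ) :
    cutDistGraph G ν W ≤ η + 2 * κ + δ := by
  obtain ⟨v₀, hv₀⟩ := hnone
  have : Nonempty V := ⟨v₀⟩
  have hcardpos : (0 : ℝ) < Fintype.card V := by exact_mod_cast Fintype.card_pos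
  set u : Measure V := uniformOn (Set.univ : Set V) with hu
  have hup : IsProbabilityMeasure u := isProbabilityMeasure_uniformOn Set.finite_univ
    Set.univ_nonempty
  have husing : ∀ v, u.real {v} = 1 / Fintype.card V := by
    intro v
    rw [Measure.real, hu, uniformOn_univ]
    simp
  have hnone' : u (c ⁻¹' {none}) ≠ 0 := by
    intro h
    have h1 : u.real {v₀} = 0 := by
      rw [measureReal_def, measure_mono_null (t := c ⁻¹' {none}) (Set.singleton_subset_iff.2 hv₀) h]; rfl
    rw [husing] at h1
    exact (one_div_pos.2 hcardpos).ne' h1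
  obtain ⟨P, hPp, hP1, hP2, hPmis⟩ := exists_coupling u ν c π (fun i => hπ (.of_discrete))
    (fun i => (ENNReal.toReal_le_toReal (measure_ne_top _ _) (measure_ne_top _ _)).1 (hle i)) hnone'
  set M : Set (V × S) := {z | c z.1 ≠ some (π z.2)} with hM
  have hMmeas : MeasurableSet M := by
    have : Measurable fun z : V × S => (z.1, π z.2) :=
      measurable_fst.prodMk (hπ.comp measurable_snd)
    exact this (MeasurableSet.of_discrete (s := {p : V × ι | c p.1 ≠ some p.2}))
  have hMκ : P.real M ≤ κ :=
    (ENNReal.toReal_mono (measure_ne_top _ _) hPmis).trans hκ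
  have hdist : cutDistGraph G ν W ≤
      cutNorm P fun x y => (graphonOf G).toFun x.1 y.1 - W.toFun x.2 y.2 := by
    rw [cutDistGraph, cutDist]
    refine csInf_le ⟨0, ?_⟩ ⟨V × S, inferInstance, P, Prod.fst, Prod.snd, hPp, hP1, hP2, rfl⟩
    rintro r ⟨Ω, _, P, φ₁, φ₂, -, -, -, rfl⟩
    exact cutNorm_nonneg _ _
  refine hdist.trans ?_
  set a : V → V → ℝ := (graphonOf G).toFun with ha
  -- Three errors: `F₁` is controlled by quasirandomness, `F₂` vanishes unless one of the points
  -- lies in the mismatch set `M`, and `F₃` by the L¹ approximation.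
  set F₁ : (V × S) × (V × S) → ℝ := fun z =>
    a z.1.1 z.2.1 - extendKernel w (c z.1.1) (c z.2.1) with hF₁
  set F₂ : (V × S) × (V × S) → ℝ := fun z =>
    extendKernel w (c z.1.1) (c z.2.1) - w (π z.1.2) (π z.2.2) with hF₂
  set F₃ : (V × S) × (V × S) → ℝ := fun z =>
    w (π z.1.2) (π z.2.2) - W.toFun z.1.2 z.2.2 with hF₃
  have hext : Measurable fun z : (V × S) × (V × S) => extendKernel w (c z.1.1) (c z.2.1) :=
    measurable_step measurable_fst fun x y => extendKernel w (c x) (c y)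
  have ham : Measurable fun z : (V × S) × (V × S) => a z.1.1 z.2.1 :=
    measurable_step measurable_fst a
  have hwm : Measurable fun z : (V × S) × (V × S) => w (π z.1.2) (π z.2.2) :=
    measurable_step (hπ.comp measurable_snd) w
  have hWm : Measurable fun z : (V × S) × (V × S) => W.toFun z.1.2 z.2.2 :=
    W.measurable.comp ((measurable_snd.comp measurable_fst).prodMk
      (measurable_snd.comp measurable_snd))
  have hF₁i : Integrable F₁ (P.prod P) := integrable_of_abs_le_one (ham.sub hext) fun z =>
    abs_sub_le_one_of_mem_Icc ((graphonOf G).mem_Icc _ _) (extendKernel_mem_Icc hw _ _)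
  have hF₂i : Integrable F₂ (P.prod P) := integrable_of_abs_le_one (hext.sub hwm) fun z =>
    abs_sub_le_one_of_mem_Icc (extendKernel_mem_Icc hw _ _) (hw _ _)
  have hF₃i : Integrable F₃ (P.prod P) := integrable_of_abs_le_one (hwm.sub hWm) fun z =>
    abs_sub_le_one_of_mem_Icc (hw _ _) (W.mem_Icc _ _)
  have hF₁₂i : Integrable (fun z => F₁ z + F₂ z) (P.prod P) := hF₁i.add hF₂i
  have hI₃ : ∫ z, |F₃ z| ∂(P.prod P) ≤ δ := by
    have hmp := hP2.prod hP2
    have hmeas : Measurable fun z : S × S => |W.toFun z.1 z.2 - w (π z.1) (π z.2)| :=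
      (W.measurable.sub (measurable_step hπ w)).abs
    refine le_trans (le_of_eq ?_) hL1
    rw [← hmp.map_eq, integral_map hmp.measurable.aemeasurable hmeas.aestronglyMeasurable]
    refine integral_congr_ae (ae_of_all _ fun z => ?_)
    exact abs_sub_comm _ _
  have hI₂ : ∫ z, |F₂ z| ∂(P.prod P) ≤ 2 * κ := by
    have hind : ∀ z, |F₂ z| ≤ (Prod.fst ⁻¹' M).indicator 1 z + (Prod.snd ⁻¹' M).indicator 1 z := by
      intro z
      have hpos : ∀ (E : Set ((V × S) × (V × S))), (0 : ℝ) ≤ E.indicator 1 z := fun E =>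
        Set.indicator_nonneg (fun _ _ => zero_le_one) _
      by_cases h1 : z.1 ∈ M
      · rw [Set.indicator_of_mem (s := Prod.fst ⁻¹' M) h1]
        have := abs_sub_le_one_of_mem_Icc (extendKernel_mem_Icc hw (c z.1.1) (c z.2.1))
          (hw (π z.1.2) (π z.2.2))
        exact this.trans (le_add_of_nonneg_right (hpos _))
      · by_cases h2 : z.2 ∈ M
        · rw [Set.indicator_of_mem (s := Prod.snd ⁻¹' M) h2]
          have := abs_sub_le_one_of_mem_Icc (extendKernel_mem_Icc hw (c z.1.1) (c z.2.1))
            (hw (π z.1.2) (π z.2.2))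
          exact this.trans (le_add_of_nonneg_left (hpos _))
        · have e1 : c z.1.1 = some (π z.1.2) := not_not.1 h1
          have e2 : c z.2.1 = some (π z.2.2) := not_not.1 h2
          have : F₂ z = 0 := by simp only [hF₂, e1, e2, extendKernel_some, sub_self]
          rw [this, abs_zero]
          exact add_nonneg (hpos _) (hpos _)
    have hm1 : MeasurableSet (Prod.fst ⁻¹' M : Set ((V × S) × (V × S))) := measurable_fst hMmeas
    have hm2 : MeasurableSet (Prod.snd ⁻¹' M : Set ((V × S) × (V × S))) := measurable_snd hMmeas
    have hi : ∀ {E : Set ((V × S) × (V × S))}, MeasurableSet E →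
        Integrable (E.indicator (1 : (V × S) × (V × S) → ℝ)) (P.prod P) := fun hE =>
      (integrable_const (1 : ℝ)).indicator hE
    refine (integral_mono hF₂i.abs ((hi hm1).add (hi hm2)) hind).trans ?_
    simp only [Pi.add_apply]
    rw [integral_add (hi hm1) (hi hm2), integral_indicator_one hm1, integral_indicator_one hm2,
      ← Set.prod_univ, ← Set.univ_prod, measureReal_prod_prod, measureReal_prod_prod, probReal_univ]
    linarith
  -- `T` and `U` need not be unions of fibres over `V`. Their fibre masses, rescaled by `|V|`, are
  -- weights in `[0, 1]`, which is why `hcut` is about bounded functions and not sets.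
  have hI₁ : ∀ T U : Set (V × S), |∫ z in T ×ˢ U, F₁ z ∂(P.prod P)| ≤ η := by
    intro T U
    have hfib : ∀ (T : Set (V × S)) x,
        |(Fintype.card V : ℝ) * P.real (T ∩ Prod.fst ⁻¹' {x})| ≤ 1 := by
      intro T x
      rw [abs_of_nonneg (by positivity)]
      have h1 : P.real (T ∩ Prod.fst ⁻¹' {x}) ≤ 1 / Fintype.card V := by
        rw [← husing x, ← hP1.measureReal_preimage
          (MeasurableSet.of_discrete).nullMeasurableSet]
        exact measureReal_mono Set.inter_subset_right
      calc _ ≤ (Fintype.card V : ℝ) * (1 / Fintype.card V) := by gcongr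
        _ = 1 := by field_simp
    have h := hcut (fun x => Fintype.card V * P.real (T ∩ Prod.fst ⁻¹' {x}))
      (fun x => Fintype.card V * P.real (U ∩ Prod.fst ⁻¹' {x})) (hfib T) (hfib U)
    have heq := setIntegral_prod_finite P (measurable_fst (α := V) (β := S))
      (fun x y => a x y - extendKernel w (c x) (c y)) T U
    have hscale : ∑ x, ∑ y, Fintype.card V * P.real (T ∩ Prod.fst ⁻¹' {x}) *
        (Fintype.card V * P.real (U ∩ Prod.fst ⁻¹' {y})) *
          ((if G.Adj x y then 1 else 0) - extendKernel w (c x) (c y)) =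
        (Fintype.card V : ℝ) ^ 2 * ∫ z in T ×ˢ U, F₁ z ∂(P.prod P) := by
      simp only [hF₁]
      rw [heq, Finset.mul_sum]
      refine Finset.sum_congr rfl fun x _ => ?_
      rw [Finset.mul_sum]
      refine Finset.sum_congr rfl fun y _ => ?_
      change _ = _ * (_ * ((if G.Adj x y then (1 : ℝ) else 0) - _))
      ring
    rw [hscale, abs_mul, abs_of_nonneg (by positivity), mul_comm] at h
    exact le_of_mul_le_mul_right h (by positivity)
  have hη : 0 ≤ η := (abs_nonneg _).trans (hI₁ ∅ ∅)
  have hκ0 : 0 ≤ κ := measureReal_nonneg.trans hκ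
  have hδ : 0 ≤ δ := (integral_nonneg fun _ => abs_nonneg _).trans hL1
  refine Real.sSup_le ?_ (by positivity)
  rintro r ⟨T, U, -, -, rfl⟩
  have hsum : ∫ z in T ×ˢ U, (a z.1.1 z.2.1 - W.toFun z.1.2 z.2.2) ∂(P.prod P) =
      ∫ z in T ×ˢ U, F₁ z ∂(P.prod P) + ∫ z in T ×ˢ U, F₂ z ∂(P.prod P) +
        ∫ z in T ×ˢ U, F₃ z ∂(P.prod P) := by
    rw [← integral_add hF₁i.integrableOn hF₂i.integrableOn,
      ← integral_add hF₁₂i.integrableOn hF₃i.integrableOn]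
    refine integral_congr_ae (ae_of_all _ fun z => ?_)
    simp only [hF₁, hF₂, hF₃]
    ring
  rw [hsum]
  refine (abs_add_three _ _ _).trans ?_
  exact add_le_add (add_le_add (hI₁ T U) ((abs_setIntegral_le hF₂i _).trans hI₂))
    ((abs_setIntegral_le hF₃i _).trans hI₃)

/-! ### Initial segments as graphs of the process -/

lemma verts_eq_range {Γ : SimpleGraph ℕ} (hhub : ∀ n, n ≠ 0 → Γ.Adj 0 n) {y : ℕ → Sym2 ℕ}
    {m n : ℕ} (hn : n ≠ 0) (h : edges y m = initialEdges Γ n) :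
    verts y m = Finset.range (n + 1) := by
  ext x
  simp only [verts, h, Finset.mem_biUnion, Finset.mem_range, Sym2.mem_toFinset]
  constructor
  · rintro ⟨e, he, hx⟩
    induction e using Sym2.ind with
    | _ i j =>
      obtain ⟨-, hi, hj⟩ := mk_mem_initialEdges.1 he
      rcases Sym2.mem_iff.1 hx with rfl | rfl <;> omega
  -- Every vertex lies on an edge to the hub `0`; for `0` itself `n ≠ 0` is needed.
  · intro hx
    rcases eq_or_ne x 0 with rfl | hx0
    · exact ⟨s(0, n), mk_mem_initialEdges.2 ⟨hhub n hn, Nat.zero_le _, le_rfl⟩,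
        Sym2.mem_mk_left _ _⟩
    · exact ⟨s(0, x), mk_mem_initialEdges.2 ⟨hhub x hx0, Nat.zero_le _, by omega⟩,
        Sym2.mem_mk_right _ _⟩

lemma simpleGraph_adj_iff {Γ : SimpleGraph ℕ} {y : ℕ → Sym2 ℕ} {m n : ℕ}
    (h : edges y m = initialEdges Γ n) (hv : verts y m = Finset.range (n + 1))
    (i j : verts y m) : (simpleGraph y m).Adj i j ↔ Γ.Adj i.1 j.1 := by
  change s(i.1, j.1) ∈ edges y m ↔ _
  rw [h, mk_mem_initialEdges]
  have hi := Finset.mem_range.1 (hv ▸ i.2 : i.1 ∈ Finset.range (n + 1))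
  have hj := Finset.mem_range.1 (hv ▸ j.2 : j.1 ∈ Finset.range (n + 1))
  exact ⟨fun h => h.1, fun h => ⟨h, by omega, by omega⟩⟩

lemma uniformOn_real_preimage {κ : Type*} [DecidableEq κ] (A : Finset ℕ) (c : ℕ → κ) (o : κ) :
    (uniformOn (Set.univ : Set A)).real ((fun v : A => c v) ⁻¹' {o}) =
      ((A.filter fun x => c x = o).card : ℝ) / A.card := by
  have h1 : (fun v : A => c v) ⁻¹' {o} =
      ((Finset.univ.filter fun v : A => c v = o : Finset A) : Set A) := by
    ext v; simp
  have h2 : (Finset.univ.filter fun v : A => c v = o).card =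
      (A.filter fun x => c x = o).card := by
    rw [Finset.card_filter, Finset.card_filter]
    exact Finset.sum_coe_sort A fun x => if c x = o then 1 else 0
  rw [measureReal_def, uniformOn_univ, h1, Measure.count_apply_finset, h2, ENNReal.toReal_div]
  simp

/-! ### Equally large classes in prescribed proportions -/

lemma exists_map_fin_card_fiber {κ : Type*} [Fintype κ] [DecidableEq κ] (k : κ → ℕ) :
    ∃ d : Fin (∑ o, k o) → κ, ∀ o, (Finset.univ.filter fun x => d x = o).card = k o := by
  let e : Fin (∑ o, k o) ≃ Σ o, Fin (k o) := Fintype.equivOfCardEq (by simp)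
  refine ⟨fun x => (e x).1, fun o => ?_⟩
  rw [Finset.card_filter, e.sum_comp fun p => if p.1 = o then 1 else 0, Fintype.sum_sigma,
    Finset.sum_eq_single_of_mem o (Finset.mem_univ o) fun i _ hi => by simp [hi]]
  simp

lemma card_filter_bind {α κ ι : Type*} [Fintype κ] [DecidableEq κ] [DecidableEq ι] (A : Finset α) (c : α → Option κ)
    (d : κ → Option ι) (o : Option ι) :
    (A.filter fun x => (c x).bind d = o).card =
      (if none = o then (A.filter fun x => c x = none).card else 0) +
        ∑ k, if d k = o then (A.filter fun x => c x = some k).card else 0 := by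
  rw [Finset.card_eq_sum_card_fiberwise (f := c) (t := Finset.univ) fun _ _ => Finset.mem_univ _,
    Fintype.sum_option]
  have h : ∀ p : Option κ, ((A.filter fun x => (c x).bind d = o).filter fun x => c x = p).card =
      if p.bind d = o then (A.filter fun x => c x = p).card else 0 := by
    intro p
    rw [Finset.filter_filter]
    split_ifs with hp
    · congr 1
      refine Finset.filter_congr fun x _ => ⟨fun h => h.2, fun h => ⟨by rw [h, hp], h⟩⟩
    · rw [Finset.card_eq_zero, Finset.filter_eq_empty_iff]
      rintro x - ⟨h1, h2⟩
      exact hp (h2 ▸ h1)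
  simp only [h]
  rfl

/-- The floors of the multiples `a i * M`, and the rest up to `M`. -/
def roundedCounts {r : ℕ} (a : Fin r → ℝ) (M : ℕ) : Option (Fin r) → ℕ
  | some i => ⌊a i * M⌋₊
  | none => M - ∑ i, ⌊a i * M⌋₊

lemma sum_floor_le {r : ℕ} {a : Fin r → ℝ} (ha : ∀ i, 0 ≤ a i) (hsum : ∑ i, a i = 1) (M : ℕ) :
    ∑ i, ⌊a i * M⌋₊ ≤ M := by
  have : ((∑ i, ⌊a i * M⌋₊ : ℕ) : ℝ) ≤ M := by
    push_cast
    calc ∑ i, (⌊a i * M⌋₊ : ℝ) ≤ ∑ i, a i * M :=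
          Finset.sum_le_sum fun i _ => Nat.floor_le (mul_nonneg (ha i) (Nat.cast_nonneg _))
      _ = M := by rw [← Finset.sum_mul, hsum, one_mul]
  exact_mod_cast this

lemma sum_roundedCounts {r : ℕ} {a : Fin r → ℝ} (ha : ∀ i, 0 ≤ a i) (hsum : ∑ i, a i = 1)
    (M : ℕ) : ∑ o, roundedCounts a M o = M := by
  rw [Fintype.sum_option]
  exact Nat.sub_add_cancel (sum_floor_le ha hsum M)

/-- Each of the `r` floors loses less than `1`. -/
lemma roundedCounts_none_le {r : ℕ} {a : Fin r → ℝ} (hsum : ∑ i, a i = 1) (M : ℕ) :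
    roundedCounts a M none ≤ r := by
  rw [roundedCounts, Nat.sub_le_iff_le_add]
  have : (M : ℝ) ≤ ((r + ∑ i, ⌊a i * M⌋₊ : ℕ) : ℝ) := by
    push_cast
    calc (M : ℝ) = ∑ i, a i * M := by rw [← Finset.sum_mul, hsum, one_mul]
      _ ≤ ∑ i, (1 + (⌊a i * M⌋₊ : ℝ)) := Finset.sum_le_sum fun i _ => by
          linarith [Nat.lt_floor_add_one (a i * M)]
      _ = _ := by rw [Finset.sum_add_distrib]; simp
  exact_mod_cast this

/-! ### Density of the initial segments, and the theorem -/

/-- Initial segments of the universal graph come arbitrarily close to each graphon. -/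
lemma exists_initialEdges_cutDistGraph_le {Γ : SimpleGraph ℕ} (hhub : ∀ n, n ≠ 0 → Γ.Adj 0 n)
    (hΓ : ∀ t : Template, ApproximatesDensities Γ t.density) {S : Type v} [MeasurableSpace S] (ν : Measure S)
    [IsProbabilityMeasure ν] (W : Graphon S) {ε : ℝ} (hε : 0 < ε) (n₀ : ℕ) :
    ∃ n, n₀ ≤ n ∧ ∀ (y : ℕ → Sym2 ℕ) (m : ℕ), edges y m = initialEdges Γ n →
      cutDistGraph (simpleGraph y m) ν W ≤ ε := by
  classical
  -- The final bound `η + 2 * κ + δ` has `η = δ = ε / 6` and `κ = 2 * (ε / 6)`: the exceptional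
  -- vertices come from the segment itself and from rounding.
  obtain ⟨r, π, w, hπ, hwsymm, hwmem, hL1⟩ := W.exists_step_approx ν (ε := ε / 6) (by positivity)
  set a : Fin r → ℝ := fun i => ν.real (π ⁻¹' {i}) with ha
  have ha0 : ∀ i, 0 ≤ a i := fun i => measureReal_nonneg
  have hasum : ∑ i, a i = 1 := by
    have h := sum_measureReal_preimage_singleton (μ := ν) (f := π) Finset.univ
      fun i _ => hπ (.of_discrete)
    simpa using h
  obtain ⟨M, hM⟩ := exists_nat_gt ((r : ℝ) / (ε / 6))
  have hM0 : (0 : ℝ) < M := lt_of_le_of_lt (by positivity) hM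
  have hrM : (r : ℝ) ≤ ε / 6 * M := by
    rw [div_lt_iff₀ (by positivity)] at hM
    linarith
  -- Rounding down keeps the vertex mass of part `i` at most `a i`, as the coupling requires.
  obtain ⟨d, hd⟩ : ∃ d : Fin M → Option (Fin r),
      ∀ o, (Finset.univ.filter fun x => d x = o).card = roundedCounts a M o := by
    have h := exists_map_fin_card_fiber (roundedCounts a M)
    rwa [sum_roundedCounts ha0 hasum] at h
  let t : Template :=
    { size := M
      size_pos := by exact_mod_cast hM0
      density := fun k l => extendKernel w (d k) (d l)
      symm := fun k l => extendKernel_comm hwsymm _ _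
      mem_Icc := fun k l => extendKernel_mem_Icc hwmem _ _ }
  have ht : ApproximatesDensities Γ fun k l => extendKernel w (d k) (d l) := hΓ t
  -- A segment with `N` vertices ends at `n = N - 1`; the `+ 2` gives `n₀ ≤ n` and `n ≠ 0`.
  obtain ⟨N, hN, c, hc0, hcle, hcge, hcut⟩ := ht (ε / 6) (by positivity) (n₀ + 2)
  obtain ⟨n, rfl⟩ : ∃ n, N = n + 1 := ⟨N - 1, by omega⟩
  have hN0 : (0 : ℝ) < (n + 1 : ℕ) := by positivity
  set s : Option (Fin M) → ℝ := fun k =>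
    (((Finset.range (n + 1)).filter fun x => c x = k).card : ℝ) with hs
  have hsle : ∀ k : Fin M, s (some k) ≤ (n + 1 : ℕ) / M := fun k => by
    rw [le_div_iff₀ hM0]
    simp only [hs]
    exact_mod_cast hcle k
  have hsum_le : ∀ o, (∑ k : Fin M, if d k = o then s (some k) else 0) ≤
      roundedCounts a M o * ((n + 1 : ℕ) / M) := fun o => by
    rw [← hd o, ← Finset.sum_filter, ← nsmul_eq_mul]
    exact Finset.sum_le_card_nsmul _ _ _ fun k _ => hsle k
  have hbind : ∀ o, ((((Finset.range (n + 1)).filter fun x => (c x).bind d = o).card : ℕ) : ℝ) =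
      (if none = o then s none else 0) + ∑ k : Fin M, if d k = o then s (some k) else 0 := by
    intro o
    rw [card_filter_bind]
    push_cast
    rfl
  have hsnone : s none ≤ ε / 6 * (n + 1 : ℕ) := by
    have h1 : ∑ k, s k = (n + 1 : ℕ) := by
      simp only [hs]
      rw [← Nat.cast_sum, ← Finset.card_eq_sum_card_fiberwise fun _ _ => Finset.mem_univ _,
        Finset.card_range]
    rw [Fintype.sum_option] at h1
    have h2 : (1 - ε / 6) * (n + 1 : ℕ) ≤ ∑ k : Fin M, s (some k) := by
      have h3 : ∑ k : Fin M, (1 - ε / 6) * (n + 1 : ℕ) / M ≤ ∑ k : Fin M, s (some k) :=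
        Finset.sum_le_sum fun k _ => by
          rw [div_le_iff₀ hM0]
          exact hcge k
      refine le_trans (le_of_eq ?_) h3
      rw [Finset.sum_const, Finset.card_univ, Fintype.card_fin, nsmul_eq_mul]
      field_simp
    linarith
  refine ⟨n, by omega, fun y m hy => ?_⟩
  have hv : verts y m = Finset.range (n + 1) := verts_eq_range hhub (by omega) hy
  have hreal : ∀ o, (uniformOn (Set.univ : Set (verts y m))).real
      ((fun v : verts y m => (c v).bind d) ⁻¹' {o}) =
      ((if none = o then s none else 0) +
        ∑ k : Fin M, if d k = o then s (some k) else 0) / (n + 1 : ℕ) := by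
    intro o
    rw [uniformOn_real_preimage (verts y m) (fun x => (c x).bind d), hv, Finset.card_range, hbind]
  have hcard : (Fintype.card (verts y m) : ℝ) = (n + 1 : ℕ) := by
    rw [Fintype.card_coe, hv, Finset.card_range]
  have hwmem' : ∀ i j, (w i j : ℝ) ∈ Set.Icc (0 : ℝ) 1 := fun i j =>
    ⟨by exact_mod_cast (hwmem i j).1, by exact_mod_cast (hwmem i j).2⟩
  have hfinal := cutDistGraph_le (simpleGraph y m) ν W (fun v => (c v).bind d) hπ
    (w := fun i j => (w i j : ℝ)) hwmem' (η := ε / 6) (κ := ε / 6 + ε / 6) (δ := ε / 6)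
    ?_ hL1 ?_ ?_ ?_
  · linarith
  · intro f g hf hg
    let ext : (verts y m → ℝ) → ℕ → ℝ := fun f x => if h : x ∈ verts y m then f ⟨x, h⟩ else 0
    have hext1 : ∀ f : verts y m → ℝ, (∀ x, |f x| ≤ 1) → ∀ x, |ext f x| ≤ 1 := by
      intro f hf x
      simp only [ext]
      split_ifs
      · exact hf _
      · simp
    have hext2 : ∀ (f : verts y m → ℝ) (x : verts y m), ext f x = f x := fun f x => by
      simp only [ext, x.2, dif_pos]
    have h := hcut (ext f) (ext g) (hext1 f hf) (hext1 g hg)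
    rw [hcard]
    refine le_trans (le_of_eq ?_) h
    congr 1
    symm
    rw [← hv, ← Finset.sum_coe_sort]
    refine Finset.sum_congr rfl fun x _ => ?_
    rw [← Finset.sum_coe_sort]
    refine Finset.sum_congr rfl fun z _ => ?_
    rw [hext2, hext2, extendKernel_bind]
    simp only [simpleGraph_adj_iff hy hv]
  · intro i
    rw [hreal, if_neg (by simp), zero_add, div_le_iff₀ hN0]
    refine (hsum_le _).trans ?_
    have h1 : (roundedCounts a M (some i) : ℝ) ≤ a i * M :=
      Nat.floor_le (mul_nonneg (ha0 i) hM0.le)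
    calc (roundedCounts a M (some i) : ℝ) * ((n + 1 : ℕ) / M) ≤ a i * M * ((n + 1 : ℕ) / M) := by
          gcongr
      _ = a i * (n + 1 : ℕ) := by field_simp
  · exact ⟨⟨0, by rw [hv]; simp⟩, by simp [hc0]⟩
  · rw [hreal, if_pos rfl, div_le_iff₀ hN0, add_mul]
    refine add_le_add hsnone ((hsum_le _).trans ?_)
    have h1 : (roundedCounts a M none : ℝ) ≤ r := by
      exact_mod_cast roundedCounts_none_le hasum M
    calc (roundedCounts a M none : ℝ) * ((n + 1 : ℕ) / M) ≤ ε / 6 * M * ((n + 1 : ℕ) / M) := by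
          gcongr; exact h1.trans hrM
      _ = _ := by field_simp

/-- If all but finitely many initial segments of the universal graph are seen, then each graphon is
a limit along a subsequence. -/
lemma exists_convergesAlong {Γ : SimpleGraph ℕ} (hhub : ∀ n, n ≠ 0 → Γ.Adj 0 n)
    (hΓ : ∀ t : Template, ApproximatesDensities Γ t.density) {y : ℕ → Sym2 ℕ} {τ : ℕ → ℕ} (hτ : StrictMono τ)
    (hy : ∀ᶠ n in atTop, edges y (τ n) = initialEdges Γ n) {S : Type v} [MeasurableSpace S]
    (ν : Measure S) [IsProbabilityMeasure ν] (W : Graphon S) :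
    ∃ m : ℕ → ℕ, StrictMono m ∧ ConvergesAlong y m ν W := by
  have hfreq : ∀ l : ℕ, ∃ᶠ n in atTop,
      cutDistGraph (simpleGraph y (τ n)) ν W ≤ 1 / ((l : ℝ) + 1) := by
    intro l
    obtain ⟨n₁, hn₁⟩ := eventually_atTop.1 hy
    refine frequently_atTop.2 fun n₀ => ?_
    obtain ⟨n, hn, h⟩ := exists_initialEdges_cutDistGraph_le hhub hΓ ν W
      (ε := 1 / ((l : ℝ) + 1)) (by positivity) (max n₀ n₁)
    exact ⟨n, (le_max_left _ _).trans hn, h y (τ n) (hn₁ n ((le_max_right _ _).trans hn))⟩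
  obtain ⟨φ, hφ, hφd⟩ := extraction_forall_of_frequently hfreq
  refine ⟨τ ∘ φ, hτ.comp hφ, ?_, ?_⟩
  · have hcard : ∀ᶠ n in atTop, (verts y (τ n)).card = n + 1 := by
      filter_upwards [hy, eventually_ne_atTop 0] with n hn hn0
      rw [verts_eq_range hhub hn0 hn, Finset.card_range]
    have h1 : Tendsto (fun n => (verts y (τ n)).card) atTop atTop :=
      (tendsto_add_atTop_nat 1).congr' (hcard.mono fun n hn => hn.symm)
    exact h1.comp hφ.tendsto_atTop
  · exact squeeze_zero (fun l => cutDist_nonneg _ _ _ _) hφd tendsto_one_div_add_atTop_nhds_zero_nat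

end EdgeExchangeable

end

theorem theorem8p1 :
    ∃ μ : IntensityMatrix,
      ∀ (Ω : Type u) [MeasurableSpace Ω] (P : Measure Ω) [IsProbabilityMeasure P]
        (Y : ℕ → Ω → Sym2 ℕ), (∀ i, HasLaw (Y i) μ.edgeLaw P) → iIndepFun Y P →
        ∀ᵐ ω ∂P, ∀ (S : Type v) [MeasurableSpace S] (ν : Measure S) [IsProbabilityMeasure ν]
          (W : Graphon S),
          ∃ m : ℕ → ℕ, StrictMono m ∧ ConvergesAlong (fun i => Y i ω) m ν W := by
  obtain ⟨Γ, hhub, hΓ⟩ := exists_universal_graph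
  refine ⟨rapidIntensity Γ ⟨0, 1, hhub 1 one_ne_zero⟩, fun Ω _ P _ Y hY hind => ?_⟩
  -- The null set comes from the edge process alone, so one `ω` serves all `S`, `ν` and `W`.
  filter_upwards [ae_eventually_edges_eq Γ _ P Y hY hind] with ω hω S _ ν _ W
  exact exists_convergesAlong hhub hΓ rapidTime_strictMono hω ν W
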